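/- **Setting.** Let $h\ge 1$ be the number of honest nodes. For a family $x=(x^{(j)})_{j\in[h]}$ of vectors of $\mathbb R^d$ put $\bar x=\frac1h\sum_j x^{(j)}$ and $\Delta_2(x)=\max_{j,k}\|x^{(j)}-x^{(k)}\|_2$. A (randomized) distributed algorithm $\mathrm{Avg}$ *achieves Byzantine $C$-averaging agreement* if for every parameter $N\in\mathbb N$, every family $x$ of honest inputs and every Byzantine attack $\mathrm{Byz}$, the family $y=\mathrm{Avg}_N(x,\mathrm{Byz})$ of honest outputs satisfies $$\mathbb E\,\Delta_2(y)^2\le \frac{\Delta_2(x)^2}{4^N}\quad\text{and}\quad \mathbb E\,\|\bar y-\bar x\|^2\le C^2\Delta_2(x)^2 .$$ Honest node $j$ has a local data distribution $\mathcal D_j$ and the local loss $\mathcal L^{(j)}(\theta)=\mathbb E_{x\sim\mathcal D_j}[\ell(\theta,x)]$, where $\ell$ is differentiable in $\theta$. Let $\bar{\mathcal L}=\frac1h\sum_j\mathcal L^{(j)}$ and assume: 1. $\mathcal L^{(j)}\ge 0$ for all $j$; 2. each $\mathcal L^{(j)}$ is differentiable with $\|\nabla\mathcal L^{(j)}(\theta)-\nabla\mathcal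 L^{(j)}(\theta')\|\le L\|\theta-\theta'\|$; 3. $\mathbb E_{x\sim\mathcal D_j}\|\nabla_\theta\ell(\theta,x)-\nabla\mathcal L^{(j)}(\theta)\|^2\le\sigma^2$ for all $j,\theta$, and all data samplings are independent; 4. $\mathcal L^{(j)}(\theta_1)\le\mathcal L_{max}$ for all $j$, where $\theta_1\in\mathbb R^d$ is the common initial parameter. Let $K=\sup_{j,k}\sup_\theta\|\nabla\mathcal L^{(j)}(\theta)-\nabla\mathcal L^{(k)}(\theta)\|$, and assume $0<K<\infty$. **The algorithm $\mathrm{Learn}$** (input $\delta>0$, batch sizes $b_t\ge1$, number of iterations $T$). Put $\eta=\delta/(12L)$ and $\theta_1^{(j)}=\theta_1$ for all $j$. For $t=1,\dots,T$: * $g_t^{(j)}=\frac1{b_t}\sum_{i\le b_t}\nabla_\theta\ell(\theta_t^{(j)},x_{t,i}^{(j)})$ with fresh samples $x_{t,i}^{(j)}\sim\mathcal D_j$; * $\gamma_t=\mathrm{Avg}_{\lceil\log_2 t\rceil}(g_t,\mathrm{Byz})$; * $\theta_{t+1/2}=\theta_t-\eta\gamma_t$; * $\theta_{t+1}=\mathrm{Avg}_1(\theta_{t+1/2},\mathrm{Byz})$.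 Return the family $\theta_*$, where $*$ is uniform on $\{1,\dots,T\}$ and independent of the iterations. In each execution of $\mathrm{Avg}$ the adversary may choose any attack, based on everything that has happened in the system so far. **Theorem.** Let $C>0$. There is a constant $c>0$, depending only on $h,L,K,C,\sigma,\mathcal L_{max}$, such that for every $0<\delta<3$, all batch sizes $b_t\ge1$ and every $T_1$ with $b_t\ge c/\delta^2$ for all $t\ge T_1$, and every number of iterations $$T\ \ge\ \frac c\delta\,\max\Big\{\frac1{\delta^2},\,T_1\Big\},$$ the following holds. For every dimension $d$, all local data and losses and every $\theta_1$ as above, every $\mathrm{Avg}$ that achieves Byzantine $C$-averaging agreement, and every Byzantine attack, the output of $\mathrm{Learn}$ satisfies $$\mathbb E\,\Delta_2(\theta_*)^2\le\delta^2\quad\text{and}\quad \mathbb E\,\|\nabla\bar{\mathcal L}(\bar\theta_*)\|^2\le(1+\delta)^2C^2K^2 ,$$ that is, $\mathrm{Learn}$ solves Byzantine $C$-collaborative learning. -/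

import Mathlib

open MeasureTheory ProbabilityTheory
open scoped ENNReal NNReal Gradient

namespace ByzLearn

universe u v w z

set_option linter.checkUnivs false

/-- Parameter (and gradient) vectors: `ℝ^d` with its Euclidean norm. -/
abbrev Vec (d : ℕ) := EuclideanSpace ℝ (Fin d)

/-- Families of vectors, one for each of the `h` honest nodes. -/
abbrev Family (h d : ℕ) := Fin h → Vec d

/-- The `ℓ₂` diameter `max_{j,k} ‖x_j - x_k‖` of a family. -/
noncomputable def diameter {h d : ℕ} (x : Family h d) : ℝ≥0 :=
  Finset.univ.sup fun p : Fin h × Fin h => ‖x p.1 - x p.2‖₊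

/-- The average of a family. -/
noncomputable def mean {h d : ℕ} (x : Family h d) : Vec d :=
  (h : ℝ)⁻¹ • ∑ j, x j

/-! ### Averaging agreement -/

/-- A (randomized) distributed algorithm that takes a family of honest input vectors and an integer
parameter `N`, and is executed in the presence of Byzantine nodes.

`Attack` is the set of all behaviours that the adversary may adopt during one execution (arbitrary
messages of the Byzantine nodes, arbitrary delays of messages, arbitrary dependence on the course of
the execution); nothing is assumed about it, so that every communication model is covered.
For a given attack, `run N a x` is the law of the outcome of the execution on the inputs `x`: an
outcome may record everything that happened in the execution (internal randomness, exchanged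
messages), and `output` reads off the vectors that the honest nodes return. -/
structure DistributedAlgorithm (h d : ℕ) where
  Attack : Type v
  Outcome : Type w
  [measurableSpaceOutcome : MeasurableSpace Outcome]
  run : ℕ → Attack → Kernel (Family h d) Outcome
  [isMarkovKernel_run : ∀ N a, IsMarkovKernel (run N a)]
  output : ℕ → Outcome → Family h d
  measurable_output : ∀ N, Measurable (output N)

attribute [instance] DistributedAlgorithm.measurableSpaceOutcome
  DistributedAlgorithm.isMarkovKernel_run

/-- Byzantine `C`-averaging agreement: for every parameter `N`, every family `x` and every Byzantine
attack, the output `y` satisfies `𝔼 Δ₂(y)² ≤ Δ₂(x)² / 4^N` and `𝔼 ‖ȳ - x̄‖² ≤ C² Δ₂(x)²`. -/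
def DistributedAlgorithm.AchievesAveragingAgreement {h d : ℕ}
    (A : DistributedAlgorithm.{v, w} h d) (C : ℝ) : Prop :=
  ∀ (N : ℕ) (x : Family h d) (a : A.Attack),
    ∫⁻ ω, (diameter (A.output N ω) : ℝ≥0∞) ^ 2 ∂(A.run N a x) ≤ (diameter x : ℝ≥0∞) ^ 2 / 4 ^ N ∧
    ∫⁻ ω, ‖mean (A.output N ω) - mean x‖ₑ ^ 2 ∂(A.run N a x)
      ≤ ENNReal.ofReal (C ^ 2) * (diameter x : ℝ≥0∞) ^ 2

/-! ### The learning problem -/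

/-- Local data distributions `D j` of the honest nodes on a space `X` of data points, with a loss
`ℓ θ x` of the parameter `θ` at the data point `x` that is differentiable in `θ`. -/
structure LearningProblem (h d : ℕ) (X : Type u) [MeasurableSpace X] where
  ℓ : Vec d → X → ℝ
  D : Fin h → Measure X
  [isProbabilityMeasure_D : ∀ j, IsProbabilityMeasure (D j)]
  measurable_ℓ : Measurable fun p : Vec d × X => ℓ p.1 p.2
  differentiable_ℓ : ∀ x, Differentiable ℝ fun θ => ℓ θ x
  integrable_ℓ : ∀ j θ, Integrable (ℓ θ) (D j)

attribute [instance] LearningProblem.isProbabilityMeasure_D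

namespace LearningProblem

variable {h d : ℕ} {X : Type u} [MeasurableSpace X] (P : LearningProblem h d X)

/-- The local loss `L^(j)(θ) = 𝔼_{x ∼ D j} ℓ(θ, x)` of node `j`. -/
noncomputable def localLoss (j : Fin h) (θ : Vec d) : ℝ := ∫ x, P.ℓ θ x ∂(P.D j)

/-- The average of the local losses. -/
noncomputable def avgLoss (θ : Vec d) : ℝ := (h : ℝ)⁻¹ * ∑ j, P.localLoss j θ

/-- The gradient `∇_θ ℓ(θ, x)` at a single data point. -/
noncomputable def sampleGrad (θ : Vec d) (x : X) : Vec d := ∇ (fun θ' => P.ℓ θ' x) θ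

/-- The local losses are non-negative. -/
def Nonneg : Prop := ∀ j θ, 0 ≤ P.localLoss j θ

/-- The local losses are `L`-smooth. -/
def Smooth (L : ℝ) : Prop :=
  (∀ j, Differentiable ℝ (P.localLoss j)) ∧
    ∀ j θ θ', ‖∇ (P.localLoss j) θ - ∇ (P.localLoss j) θ'‖ ≤ L * ‖θ - θ'‖

/-- The variance of the gradient noise is bounded by `σ²`. -/
def BoundedVariance (σ : ℝ) : Prop :=
  ∀ j θ, ∫⁻ x, ‖P.sampleGrad θ x - ∇ (P.localLoss j) θ‖ₑ ^ 2 ∂(P.D j) ≤ ENNReal.ofReal (σ ^ 2)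

/-- The local losses at the initial parameter `θ₁` are at most `Lmax`. -/
def InitialLossLE (θ₁ : Vec d) (Lmax : ℝ) : Prop := ∀ j, P.localLoss j θ₁ ≤ Lmax

/-- `K` is the (finite) supremum over `j`, `k` and `θ` of `‖∇L^(j)(θ) - ∇L^(k)(θ)‖`. -/
def IsHeterogeneity (K : ℝ) : Prop :=
  IsLUB {r : ℝ | ∃ (j k : Fin h) (θ : Vec d),
    r = ‖∇ (P.localLoss j) θ - ∇ (P.localLoss k) θ‖} K

/-- The requirement of Byzantine `C`-collaborative learning on the law `μ` of the output family `θ`: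
`𝔼 Δ₂(θ)² ≤ δ²` and `𝔼 ‖∇L̄(θ̄)‖² ≤ (1 + δ)² C² K²`. -/
def CollaborativeGuarantee (C K δ : ℝ) (μ : Measure (Family h d)) : Prop :=
  ∫⁻ θ, (diameter θ : ℝ≥0∞) ^ 2 ∂μ ≤ ENNReal.ofReal (δ ^ 2) ∧
  ∫⁻ θ, ‖∇ P.avgLoss (mean θ)‖ₑ ^ 2 ∂μ ≤ ENNReal.ofReal ((1 + δ) ^ 2 * C ^ 2 * K ^ 2)

theorem measurable_sampleGrad : Measurable fun p : Vec d × X => P.sampleGrad p.1 p.2 := by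
  let e := EuclideanSpace.basisFun (Fin d) ℝ
  have hg : (fun p : Vec d × X => P.sampleGrad p.1 p.2) =
      fun p => ∑ i, (fderiv ℝ (fun θ' => P.ℓ θ' p.2) p.1 (e i)) • e i := by
    funext p
    rw [← e.sum_repr' (P.sampleGrad p.1 p.2)]
    refine Finset.sum_congr rfl fun i _ => ?_
    rw [real_inner_comm, sampleGrad, gradient, InnerProductSpace.toDual_symm_apply]
  rw [hg]
  refine Finset.measurable_sum _ fun i _ => Measurable.smul_const ?_ _
  refine measurable_of_tendsto_metrizable
    (f := fun (n : ℕ) (p : Vec d × X) =>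
      ((n : ℝ) + 1) • (P.ℓ (p.1 + ((n : ℝ) + 1)⁻¹ • e i) p.2 - P.ℓ p.1 p.2)) ?_ ?_
  · intro n
    refine Measurable.const_smul (g := fun p : Vec d × X =>
      P.ℓ (p.1 + ((n : ℝ) + 1)⁻¹ • e i) p.2 - P.ℓ p.1 p.2) (Measurable.sub ?_ P.measurable_ℓ)
      ((n : ℝ) + 1)
    exact P.measurable_ℓ.comp ((measurable_fst.add_const _).prodMk measurable_snd)
  · rw [tendsto_pi_nhds]
    intro p
    have hd := (P.differentiable_ℓ p.2 p.1).hasFDerivAt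
    have hc : Filter.Tendsto (fun n : ℕ => ‖(n : ℝ) + 1‖) Filter.atTop Filter.atTop :=
      tendsto_norm_atTop_atTop.comp
        (Filter.tendsto_atTop_add_const_right _ _ tendsto_natCast_atTop_atTop)
    exact hd.lim (e i) hc

end LearningProblem

/-! ### The algorithm `Learn` -/

/-- The data points drawn in one iteration: `m` for each honest node. -/
abbrev Batch (h : ℕ) (X : Type u) (m : ℕ) := Fin h → Fin m → X

namespace LearningProblem

variable {h d : ℕ} {X : Type u} [MeasurableSpace X] (P : LearningProblem h d X)

/-- All draws of one iteration are independent, those of node `j` having law `D j`. -/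
noncomputable def batchLaw (m : ℕ) : Measure (Batch h X m) :=
  Measure.pi fun j => Measure.pi fun _ : Fin m => P.D j

instance (m : ℕ) : IsProbabilityMeasure (P.batchLaw m) := by
  unfold batchLaw; infer_instance

/-- The stochastic gradients: node `j` averages `∇_θ ℓ(θ_j, x)` over its batch. -/
noncomputable def stochGrad (m : ℕ) (θ : Family h d) (s : Batch h X m) : Family h d :=
  fun j => (m : ℝ)⁻¹ • ∑ i, P.sampleGrad (θ j) (s j i)

theorem measurable_stochGrad (m : ℕ) :
    Measurable fun p : Family h d × Batch h X m => P.stochGrad m p.1 p.2 := by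
  refine measurable_pi_lambda _ fun j => ?_
  unfold stochGrad
  refine Measurable.const_smul (g := fun p : Family h d × Batch h X m =>
    ∑ i, P.sampleGrad (p.1 j) (p.2 j i)) ?_ (m : ℝ)⁻¹
  refine Finset.measurable_sum _ fun i _ => ?_
  refine P.measurable_sampleGrad.comp (Measurable.prodMk ?_ ?_)
  · exact (measurable_pi_apply j).comp measurable_fst
  · have hs : Measurable fun s : Batch h X m => s j i := by fun_prop
    exact hs.comp measurable_snd

end LearningProblem

/-- The parameter `N(t) = ⌈log₂ t⌉` of `Avg` on gradients in iteration `t`. -/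
noncomputable def agreementLevel (t : ℕ) : ℕ := ⌈Real.logb 2 t⌉₊

/-- What has happened up to the call of `Avg` on the gradients in iteration `t`: the family of
parameters, the memory of the adversary, and the data points drawn in this iteration. -/
abbrev GradView (h d : ℕ) (X : Type u) (M : Type z) (m : ℕ) := (Family h d × M) × Batch h X m

/-- A Byzantine attack on `Learn` with batch sizes `b t`. The adversary is omniscient and adaptive:
it has a memory of arbitrary type, whose initial value may be random, and in which it may store
everything that it observes. In iteration `t ≥ 1` it chooses its attack on each of the two
executions of `Avg` from its memory, all honest parameters, all drawn data points and, for the second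
execution, the full outcome of the first one; it then updates its memory from all of this and the
outcome of the second execution. All other steps of `Learn` are local computations of the honest
nodes, out of reach of the adversary. The `measurable` fields express that the choices are measurable. -/
structure LearnAttack {h d : ℕ} (A : DistributedAlgorithm.{v, w} h d) (X : Type u)
    [MeasurableSpace X] (b : ℕ → ℕ) where
  Memory : Type z
  [measurableSpaceMemory : MeasurableSpace Memory]
  init : Measure Memory
  [isProbabilityMeasure_init : IsProbabilityMeasure init]
  gradAttack : (t : ℕ) → GradView h d X Memory (b t) → A.Attack
  paramAttack : (t : ℕ) → GradView h d X Memory (b t) × A.Outcome → A.Attack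
  update : (t : ℕ) → (GradView h d X Memory (b t) × A.Outcome) × A.Outcome → Memory
  measurable_gradAttack : ∀ t, Measurable
    fun p : GradView h d X Memory (b t) × Family h d =>
      A.run (agreementLevel t) (gradAttack t p.1) p.2
  measurable_paramAttack : ∀ t, Measurable
    fun p : (GradView h d X Memory (b t) × A.Outcome) × Family h d =>
      A.run 1 (paramAttack t p.1) p.2
  measurable_update : ∀ t, Measurable (update t)

attribute [instance] LearnAttack.measurableSpaceMemory LearnAttack.isProbabilityMeasure_init

section Learn

variable {h d : ℕ} {X : Type u} [MeasurableSpace X] {b : ℕ → ℕ}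
  {A : DistributedAlgorithm.{v, w} h d}

/-- Iteration `t`, gradient aggregation: `Avg_{N(t)}` is executed on the stochastic gradients. -/
noncomputable def gradKernel (P : LearningProblem h d X) (B : LearnAttack.{u, v, w, z} A X b) (t : ℕ) :
    Kernel (GradView h d X B.Memory (b t)) A.Outcome where
  toFun z := A.run (agreementLevel t) (B.gradAttack t z) (P.stochGrad (b t) z.1.1 z.2)
  measurable' := by
    have hg : Measurable fun z : GradView h d X B.Memory (b t) => P.stochGrad (b t) z.1.1 z.2 :=
      Measurable.comp (g := fun p : Family h d × Batch h X (b t) => P.stochGrad (b t) p.1 p.2)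
        (f := fun z : GradView h d X B.Memory (b t) => (z.1.1, z.2))
        (P.measurable_stochGrad (b t)) ((measurable_fst.comp measurable_fst).prodMk measurable_snd)
    exact Measurable.comp
      (g := fun p : GradView h d X B.Memory (b t) × Family h d =>
        A.run (agreementLevel t) (B.gradAttack t p.1) p.2)
      (f := fun z => (z, P.stochGrad (b t) z.1.1 z.2))
      (B.measurable_gradAttack t) (measurable_id.prodMk hg)

/-- The local step `θ_{t+1/2} = θ_t - η γ_t`, where `γ_t` is the output of `Avg_{N(t)}`. -/
noncomputable def halfStep (B : LearnAttack.{u, v, w, z} A X b) (η : ℝ) (t : ℕ)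
    (z : GradView h d X B.Memory (b t) × A.Outcome) : Family h d :=
  z.1.1.1 - η • A.output (agreementLevel t) z.2

/-- Iteration `t`, parameter aggregation: `Avg_1` is executed on `θ_{t+1/2}`. -/
noncomputable def paramKernel (B : LearnAttack.{u, v, w, z} A X b) (η : ℝ) (t : ℕ) :
    Kernel (GradView h d X B.Memory (b t) × A.Outcome) A.Outcome where
  toFun z := A.run 1 (B.paramAttack t z) (halfStep B η t z)
  measurable' := by
    have hg : Measurable (halfStep B η t) := by
      have h1 : Measurable fun z : GradView h d X B.Memory (b t) × A.Outcome =>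
          A.output (agreementLevel t) z.2 := (A.measurable_output _).comp measurable_snd
      exact (measurable_fst.comp (measurable_fst.comp measurable_fst)).sub (h1.const_smul η)
    exact (B.measurable_paramAttack t).comp (measurable_id.prodMk hg)

instance (P : LearningProblem h d X) (B : LearnAttack.{u, v, w, z} A X b) (t : ℕ) :
    IsMarkovKernel (gradKernel P B t) :=
  ⟨fun z => inferInstanceAs (IsProbabilityMeasure (A.run _ (B.gradAttack t z) _))⟩

instance (B : LearnAttack.{u, v, w, z} A X b) (η : ℝ) (t : ℕ) :
    IsMarkovKernel (paramKernel B η t) :=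
  ⟨fun z => inferInstanceAs (IsProbabilityMeasure (A.run _ (B.paramAttack t z) _))⟩

/-- `iterateLaw P B η θ₁ i` is the joint law of the honest parameters `θ_{i+1}` and of the memory of
the adversary at the beginning of iteration `t = i + 1`. All honest nodes start from `θ₁`. -/
noncomputable def iterateLaw (P : LearningProblem h d X) (B : LearnAttack.{u, v, w, z} A X b) (η : ℝ)
    (θ₁ : Vec d) : (i : ℕ) → Measure (Family h d × B.Memory)
  | 0 => (Measure.dirac fun _ => θ₁).prod B.init
  | i + 1 =>
    ((((iterateLaw P B η θ₁ i).prod (P.batchLaw (b (i + 1)))) ⊗ₘ gradKernel P B (i + 1))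
      ⊗ₘ paramKernel B η (i + 1)).map fun z => (A.output 1 z.2, B.update (i + 1) z)

instance (P : LearningProblem h d X) (B : LearnAttack.{u, v, w, z} A X b) (η : ℝ) (θ₁ : Vec d)
    (i : ℕ) : IsProbabilityMeasure (iterateLaw P B η θ₁ i) := by
  induction i with
  | zero => unfold iterateLaw; infer_instance
  | succ i ih =>
    unfold iterateLaw
    exact Measure.isProbabilityMeasure_map
      (((A.measurable_output 1).comp measurable_snd).prodMk (B.measurable_update _)).aemeasurable

/-- The law of the output family of `Learn` on input `δ` with `T` iterations, batch sizes `b` and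
learning rate `δ / (12 L)`, under the attack `B`: the family `θ_*` for an index `*` that is uniform
on `{1, …, T}` and independent of the iterations. -/
noncomputable def learn (P : LearningProblem h d X) (B : LearnAttack.{u, v, w, z} A X b) (L δ : ℝ)
    (θ₁ : Vec d) (T : ℕ) : Measure (Family h d) :=
  (T : ℝ≥0∞)⁻¹ •
    ∑ i ∈ Finset.range T, (iterateLaw P B (δ / (12 * L)) θ₁ i).map Prod.fst

end Learn

end ByzLearn

namespace ByzLearn

universe u v w z

/-! ### Second moments -/

section SecondMoments

variable {Ω : Type*} [MeasurableSpace Ω] {μ : Measure Ω} {E : Type*} [NormedAddCommGroup E]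

/-! Follow the mean parameter. One iteration moves it by `-η • (∇L̄ + p + q + n - s)`, where `p` is
the error of the agreement on gradients, `q` the gap between the mean of the local gradients at the
nodes' own parameters and the gradient at the mean, `n` the sampling noise, and `s` the error of the
agreement on parameters divided by `η`. Only `p` is not small: its second moment is at most `C²`
times that of the diameter of the stochastic gradients, which is close to `K²`. Since `-⟪∇L̄, p⟫ ≤
‖∇L̄‖²/2 + ‖p‖²/2`, the descent lemma bounds the expected change of the loss by `η (C²K² -
‖∇L̄‖²)/2` (in expectation), up to relative errors of order `δ` and small terms
(`perturbed_gradient_step`, `IsLearnStep.moments`). Telescoping the non-negative loss bounds the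
average of `‖∇L̄‖²` by about `C²K²`.

The small terms are controlled as follows. The agreement level `⌈log₂ t⌉` divides the squared
gradient diameter by at least `t²`, and the agreement on parameters divides the squared parameter
diameter by 4; hence the squared parameter diameter is `O(η²/t²)` in expectation
(`diameter_recursion`), and `q` and `s` contribute `O(1/(δt²))`, which is summable. The noise has
conditional mean zero, so in the descent it costs only `‖n‖²` with a factor of order `Lη = δ/12`; in
the gradient diameter it costs a factor `1/δ`, which batches of size `c/δ²` compensate. The first
`T₁` iterations cost `O(1)` each. After division by `T` all this is at most `δ/4 · C²K²`
(`average_moments_le`), and `slack_le` fits it under `(1 + δ)²`.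

The adversary enters only through the agreement guarantees for fixed inputs, integrated over the
past (`compProd`); the batch is independent of parameters and memory, which yields the noise bounds
(`isLearnStep_stepLaw`). That stochastic gradients are unbiased is proved, not assumed
(`integral_inner_noise`). -/

theorem memLp_two_of_lintegral_enorm_sq_ne_top {f : Ω → E} (hf : AEStronglyMeasurable f μ)
    (h : ∫⁻ ω, ‖f ω‖ₑ ^ 2 ∂μ ≠ ∞) : MemLp f 2 μ := by
  refine ⟨hf, ?_⟩
  rw [eLpNorm_lt_top_iff_lintegral_rpow_enorm_lt_top (by norm_num) (by norm_num)]
  simpa using h.lt_top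

theorem lintegral_enorm_sq_eq {f : Ω → E} (hf : MemLp f 2 μ) :
    ∫⁻ ω, ‖f ω‖ₑ ^ 2 ∂μ = ENNReal.ofReal (∫ ω, ‖f ω‖ ^ 2 ∂μ) := by
  rw [ofReal_integral_eq_lintegral_ofReal (hf.integrable_norm_pow two_ne_zero)
    (Filter.Eventually.of_forall fun ω => by positivity)]
  refine lintegral_congr fun ω => ?_
  rw [ENNReal.ofReal_pow (norm_nonneg _), ofReal_norm]

theorem memLp_two_of_lintegral_enorm_sq_le {f : Ω → E} (hf : AEStronglyMeasurable f μ) {a : ℝ}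
    (h : ∫⁻ ω, ‖f ω‖ₑ ^ 2 ∂μ ≤ ENNReal.ofReal a) : MemLp f 2 μ :=
  memLp_two_of_lintegral_enorm_sq_ne_top hf (h.trans_lt ENNReal.ofReal_lt_top).ne

theorem integral_norm_sq_le_of_lintegral {f : Ω → E} (hf : AEStronglyMeasurable f μ) {a : ℝ}
    (ha : 0 ≤ a) (h : ∫⁻ ω, ‖f ω‖ₑ ^ 2 ∂μ ≤ ENNReal.ofReal a) : ∫ ω, ‖f ω‖ ^ 2 ∂μ ≤ a := by
  rw [lintegral_enorm_sq_eq (memLp_two_of_lintegral_enorm_sq_le hf h)] at h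
  exact (ENNReal.ofReal_le_ofReal_iff ha).1 h

/-- Means pass to pointwise limits of functions that are bounded in `L²`. -/
theorem integral_nonpos_of_tendsto_of_bounded_sq [IsProbabilityMeasure μ] {q : ℕ → Ω → ℝ}
    {f : Ω → ℝ} {a : ℝ} (ha : 0 ≤ a) (hm : ∀ n, Measurable (q n))
    (hb : ∀ n, ∫⁻ ω, ‖q n ω‖ₑ ^ 2 ∂μ ≤ ENNReal.ofReal a) (h0 : ∀ n, ∫ ω, q n ω ∂μ = 0)
    (hf : ∀ ω, Filter.Tendsto (fun n => q n ω) Filter.atTop (nhds (f ω))) (hf2 : MemLp f 2 μ) :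
    ∫ ω, f ω ∂μ ≤ 0 := by
  -- The integrand `ε x² + x + 1/(4ε)` is a non-negative perfect square, so Fatou's lemma applies to
  -- it although `q n` has no sign. The constant cancels, and the second moments cost at most `ε a`.
  have key : ∀ ε : ℝ, 0 < ε → ∫ ω, f ω ∂μ ≤ ε * a := by
    intro ε hε
    have hpos : ∀ x : ℝ, 0 ≤ ε * x ^ 2 + x + 1 / (4 * ε) := by
      intro x
      have : ε * x ^ 2 + x + 1 / (4 * ε) = ε * (x + 1 / (2 * ε)) ^ 2 := by
        field_simp; ring
      rw [this]; positivity
    have hint : ∀ {g : Ω → ℝ}, MemLp g 2 μ →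
        Integrable (fun ω => ε * g ω ^ 2 + g ω + 1 / (4 * ε)) μ ∧
        ∫ ω, (ε * g ω ^ 2 + g ω + 1 / (4 * ε)) ∂μ
          = ε * ∫ ω, g ω ^ 2 ∂μ + ∫ ω, g ω ∂μ + 1 / (4 * ε) := by
      intro g hg
      have h1 : Integrable (fun ω => ε * g ω ^ 2) μ := hg.integrable_sq.const_mul ε
      have h2 : Integrable g μ := hg.integrable (by norm_num)
      refine ⟨(h1.add h2).add (integrable_const _), ?_⟩
      have e1 := integral_add (h1.add h2) (integrable_const (μ := μ) (1 / (4 * ε)))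
      have e2 := integral_add h1 h2
      rw [integral_const_mul] at e2
      simp only [Pi.add_apply] at e1
      rw [e1, e2]
      simp
    have hqL : ∀ n, MemLp (q n) 2 μ := fun n =>
      memLp_two_of_lintegral_enorm_sq_le (hm n).aestronglyMeasurable (hb n)
    have hq : ∀ n, ∫⁻ ω, ENNReal.ofReal (ε * q n ω ^ 2 + q n ω + 1 / (4 * ε)) ∂μ
        ≤ ENNReal.ofReal (ε * a + 1 / (4 * ε)) := by
      intro n
      obtain ⟨i1, i2⟩ := hint (hqL n)
      rw [← ofReal_integral_eq_lintegral_ofReal i1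
        (Filter.Eventually.of_forall fun ω => hpos _), i2, h0 n]
      have := integral_norm_sq_le_of_lintegral (hm n).aestronglyMeasurable ha (hb n)
      simp only [Real.norm_eq_abs, sq_abs] at this
      refine ENNReal.ofReal_le_ofReal ?_
      have := mul_le_mul_of_nonneg_left this hε.le
      linarith
    have hfatou : ∫⁻ ω, ENNReal.ofReal (ε * f ω ^ 2 + f ω + 1 / (4 * ε)) ∂μ
        ≤ ENNReal.ofReal (ε * a + 1 / (4 * ε)) := by
      have hlim : ∀ ω, ENNReal.ofReal (ε * f ω ^ 2 + f ω + 1 / (4 * ε)) = Filter.liminf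
          (fun n => ENNReal.ofReal (ε * q n ω ^ 2 + q n ω + 1 / (4 * ε))) Filter.atTop := by
        intro ω
        refine (Filter.Tendsto.liminf_eq ?_).symm
        refine ENNReal.tendsto_ofReal ?_
        exact ((((hf ω).pow 2).const_mul ε).add (hf ω)).add_const _
      simp_rw [hlim]
      refine (lintegral_liminf_le fun n => ?_).trans ?_
      · exact ((((hm n).pow_const 2).const_mul ε).add (hm n)).add_const _ |>.ennreal_ofReal
      · refine Filter.liminf_le_of_le (by isBoundedDefault) fun b hb' => ?_
        obtain ⟨n, hn⟩ := hb'.exists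
        exact hn.trans (hq n)
    obtain ⟨i1, i2⟩ := hint hf2
    rw [← ofReal_integral_eq_lintegral_ofReal i1
        (Filter.Eventually.of_forall fun ω => hpos _), i2,
        ENNReal.ofReal_le_ofReal_iff (by positivity)] at hfatou
    have : 0 ≤ ε * ∫ ω, f ω ^ 2 ∂μ := mul_nonneg hε.le (integral_nonneg fun ω => by positivity)
    linarith
  refine le_of_forall_pos_le_add fun ε hε => ?_
  -- Dividing by `a + 1` rather than `a` allows `a = 0`.
  have h1 := key (ε / (a + 1)) (by positivity)
  have h2 : ε / (a + 1) * a ≤ ε := by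
    rw [div_mul_eq_mul_div, div_le_iff₀ (by positivity)]
    nlinarith
  linarith

theorem integral_eq_zero_of_tendsto_of_bounded_sq [IsProbabilityMeasure μ] {q : ℕ → Ω → ℝ}
    {f : Ω → ℝ} {a : ℝ} (ha : 0 ≤ a) (hm : ∀ n, Measurable (q n))
    (hb : ∀ n, ∫⁻ ω, ‖q n ω‖ₑ ^ 2 ∂μ ≤ ENNReal.ofReal a) (h0 : ∀ n, ∫ ω, q n ω ∂μ = 0)
    (hf : ∀ ω, Filter.Tendsto (fun n => q n ω) Filter.atTop (nhds (f ω))) (hf2 : MemLp f 2 μ) :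
    ∫ ω, f ω ∂μ = 0 := by
  refine le_antisymm (integral_nonpos_of_tendsto_of_bounded_sq ha hm hb h0 hf hf2) ?_
  have := integral_nonpos_of_tendsto_of_bounded_sq (q := fun n ω => -q n ω) (f := fun ω => -f ω)
    (μ := μ) ha (fun n => (hm n).neg) (by simpa using hb)
    (fun n => by rw [integral_neg, h0 n, neg_zero]) (fun ω => (hf ω).neg) hf2.neg
  rw [integral_neg] at this
  linarith

end SecondMoments

/-! ### Smooth functions -/

/-- The descent lemma: a function with `L`-Lipschitz gradient is below its quadratic upper model. -/
theorem le_add_inner_add_of_lipschitz_gradient {E : Type*} [NormedAddCommGroup E]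
    [InnerProductSpace ℝ E] [CompleteSpace E] {f : E → ℝ} {L : ℝ} (hf : Differentiable ℝ f)
    (hL : ∀ x y, ‖∇ f x - ∇ f y‖ ≤ L * ‖x - y‖) (x y : E) :
    f y ≤ f x + inner ℝ (∇ f x) (y - x) + L / 2 * ‖y - x‖ ^ 2 := by
  set u := y - x with hu
  -- Along the segment from `x` to `y`, subtract the quadratic model from `f`; by Cauchy-Schwarz and
  -- the Lipschitz bound the difference has non-positive derivative on `(0, 1)`.
  have hder : ∀ s : ℝ, HasDerivAt
      (fun s : ℝ => f (x + s • u) - s * inner ℝ (∇ f x) u - s ^ 2 * (L / 2 * ‖u‖ ^ 2))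
      (inner ℝ (∇ f (x + s • u) - ∇ f x) u - s * (L * ‖u‖ ^ 2)) s := by
    intro s
    have h1 : HasDerivAt (fun s : ℝ => x + s • u) u s := by
      simpa using ((hasDerivAt_id s).smul_const u).const_add x
    have h2 := ((hf (x + s • u)).hasGradientAt.hasFDerivAt.comp_hasDerivAt s h1)
    have h3 := (h2.sub ((hasDerivAt_id s).mul_const (inner ℝ (∇ f x) u))).sub
      ((hasDerivAt_pow 2 s).mul_const (L / 2 * ‖u‖ ^ 2))
    refine h3.congr_deriv ?_
    simp only [InnerProductSpace.toDual_apply_apply, inner_sub_left]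
    push_cast
    ring
  have hanti : AntitoneOn
      (fun s : ℝ => f (x + s • u) - s * inner ℝ (∇ f x) u - s ^ 2 * (L / 2 * ‖u‖ ^ 2))
      (Set.Icc 0 1) := by
    refine antitoneOn_of_deriv_nonpos (convex_Icc 0 1)
      (fun s _ => (hder s).continuousAt.continuousWithinAt)
      (fun s _ => (hder s).differentiableAt.differentiableWithinAt) fun s hs => ?_
    rw [interior_Icc] at hs
    rw [(hder s).deriv]
    have h1 := real_inner_le_norm (∇ f (x + s • u) - ∇ f x) u
    have h2 := hL (x + s • u) x
    rw [add_sub_cancel_left, norm_smul, Real.norm_of_nonneg hs.1.le] at h2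
    have h3 := mul_le_mul_of_nonneg_right h2 (norm_nonneg u)
    nlinarith
  have := hanti (Set.left_mem_Icc.2 zero_le_one) (Set.right_mem_Icc.2 zero_le_one) zero_le_one
  simp only [zero_smul, one_smul, add_zero, zero_mul, sub_zero, one_mul, one_pow, hu,
    add_sub_cancel, ne_eq, OfNat.ofNat_ne_zero, not_false_eq_true, zero_pow] at this
  rw [hu]
  linarith

/-! ### Diameters and means -/

section Family

variable {h d : ℕ}

theorem norm_sub_le_diameter (x : Family h d) (j k : Fin h) : ‖x j - x k‖ ≤ diameter x := by
  have := Finset.le_sup (f := fun p : Fin h × Fin h => ‖x p.1 - x p.2‖₊) (Finset.mem_univ (j, k))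
  exact_mod_cast this

theorem diameter_le {x : Family h d} {r : ℝ} (hr : 0 ≤ r) (hx : ∀ j k, ‖x j - x k‖ ≤ r) :
    (diameter x : ℝ) ≤ r := by
  lift r to ℝ≥0 using hr
  have : diameter x ≤ r := Finset.sup_le fun p _ => by exact_mod_cast hx p.1 p.2
  exact_mod_cast this

theorem diameter_const (v : Vec d) : diameter (fun _ : Fin h => v) = 0 := by
  simp [diameter]

@[fun_prop]
theorem measurable_diameter : Measurable (diameter : Family h d → ℝ≥0) := by
  unfold diameter
  generalize (Finset.univ : Finset (Fin h × Fin h)) = s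
  induction s using Finset.induction_on with
  | empty => simp
  | insert a s ha ih =>
    simp only [Finset.sup_insert]
    exact Measurable.sup (by fun_prop) ih

@[fun_prop]
theorem measurable_mean : Measurable (mean : Family h d → Vec d) := by
  unfold mean
  fun_prop

theorem diameter_sub_smul_le (x y : Family h d) {η : ℝ} (hη : 0 ≤ η) :
    (diameter (x - η • y) : ℝ) ≤ diameter x + η * diameter y := by
  refine diameter_le (by positivity) fun j k => ?_
  have : (x - η • y) j - (x - η • y) k = (x j - x k) - η • (y j - y k) := by
    simp only [Pi.sub_apply, Pi.smul_apply, smul_sub]; abel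
  rw [this]
  refine (norm_sub_le _ _).trans ?_
  rw [norm_smul, Real.norm_of_nonneg hη]
  gcongr
  · exact norm_sub_le_diameter x j k
  · exact norm_sub_le_diameter y j k

theorem mean_sub (x y : Family h d) : mean (x - y) = mean x - mean y := by
  simp [mean, Finset.sum_sub_distrib, smul_sub]

theorem mean_smul (η : ℝ) (x : Family h d) : mean (η • x) = η • mean x := by
  simp [mean, ← Finset.smul_sum, smul_comm η]

theorem mean_const (hh : 0 < h) (v : Vec d) : mean (fun _ : Fin h => v) = v := by
  have : (h : ℝ) ≠ 0 := by positivity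
  simp [mean, ← Nat.cast_smul_eq_nsmul ℝ, smul_smul, this]

theorem norm_mean_le {x : Family h d} {r : ℝ} (hr : 0 ≤ r) (hx : ∀ j, ‖x j‖ ≤ r) :
    ‖mean x‖ ≤ r := by
  rw [mean, norm_smul, norm_inv, Real.norm_natCast]
  rcases Nat.eq_zero_or_pos h with h0 | hh
  · subst h0; simpa using hr
  · have h1 : ‖∑ j, x j‖ ≤ h * r := by
      refine (norm_sum_le _ _).trans ((Finset.sum_le_sum fun j _ => hx j).trans ?_)
      simp
    rw [inv_mul_le_iff₀ (by positivity)]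
    exact h1

theorem norm_sub_mean_le (hh : 0 < h) (x : Family h d) (j : Fin h) :
    ‖x j - mean x‖ ≤ diameter x := by
  rw [← mean_const hh (x j), ← mean_sub]
  exact norm_mean_le (NNReal.coe_nonneg _) fun k => norm_sub_le_diameter x j k

/-- Convexity would give an additional factor `1/h`; the crude form suffices because the constant of
the theorem may depend on `h`. -/
theorem norm_mean_sq_le_sum (x : Family h d) : ‖mean x‖ ^ 2 ≤ ∑ j, ‖x j‖ ^ 2 := by
  have h1 : ‖mean x‖ ≤ √(∑ j, ‖x j‖ ^ 2) := norm_mean_le (Real.sqrt_nonneg _) fun j =>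
    Real.le_sqrt_of_sq_le (Finset.single_le_sum (f := fun j => ‖x j‖ ^ 2)
      (fun _ _ => by positivity) (Finset.mem_univ j))
  calc ‖mean x‖ ^ 2 ≤ √(∑ j, ‖x j‖ ^ 2) ^ 2 := by gcongr
    _ = _ := Real.sq_sqrt (Finset.sum_nonneg fun _ _ => by positivity)

theorem diameter_sq_le_sum (x : Family h d) : (diameter x : ℝ) ^ 2 ≤ 4 * ∑ j, ‖x j‖ ^ 2 := by
  have h0 : 0 ≤ ∑ j, ‖x j‖ ^ 2 := Finset.sum_nonneg fun _ _ => by positivity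
  have hle : ∀ j, ‖x j‖ ≤ √(∑ j, ‖x j‖ ^ 2) := fun j =>
    Real.le_sqrt_of_sq_le (Finset.single_le_sum (f := fun j => ‖x j‖ ^ 2)
      (fun _ _ => by positivity) (Finset.mem_univ j))
  have h1 : (diameter x : ℝ) ≤ 2 * √(∑ j, ‖x j‖ ^ 2) := diameter_le (by positivity) fun j k =>
    (norm_sub_le _ _).trans (by linarith [hle j, hle k])
  calc (diameter x : ℝ) ^ 2 ≤ (2 * √(∑ j, ‖x j‖ ^ 2)) ^ 2 := by gcongr
    _ = _ := by rw [mul_pow, Real.sq_sqrt h0]; norm_num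

end Family

/-! ### The gradient noise -/

/-- Cauchy-Schwarz against the constant function 1. -/
theorem sq_lintegral_le {α : Type*} [MeasurableSpace α] {μ : Measure α} {f : α → ℝ≥0∞}
    (hf : AEMeasurable f μ) : (∫⁻ a, f a ∂μ) ^ 2 ≤ μ Set.univ * ∫⁻ a, f a ^ 2 ∂μ := by
  have := ENNReal.lintegral_mul_le_Lp_mul_Lq μ Real.HolderConjugate.two_two hf
    (aemeasurable_const (b := (1 : ℝ≥0∞)))
  simp only [Pi.mul_apply, mul_one, one_pow, lintegral_one, ENNReal.rpow_ofNat] at this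
  calc (∫⁻ a, f a ∂μ) ^ 2
      ≤ ((∫⁻ a, f a ^ 2 ∂μ) ^ (1 / 2 : ℝ) * μ Set.univ ^ (1 / 2 : ℝ)) ^ 2 := by gcongr
    _ = μ Set.univ * ∫⁻ a, f a ^ 2 ∂μ := by
        rw [mul_pow, ← ENNReal.rpow_natCast, ← ENNReal.rpow_natCast, ← ENNReal.rpow_mul,
          ← ENNReal.rpow_mul]
        norm_num [mul_comm]

/-- No integrability of `f'` is needed: if the right side is infinite there is nothing to show,
otherwise the fundamental theorem of calculus applies. -/
theorem enorm_sub_le_lintegral_of_hasDerivAt {f f' : ℝ → ℝ} (hf : ∀ s, HasDerivAt f (f' s) s)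
    (hm : Measurable f') {τ : ℝ} (hτ : 0 ≤ τ) :
    ‖f τ - f 0‖ₑ ≤ ∫⁻ s in Set.Ioc 0 τ, ‖f' s‖ₑ := by
  by_cases hfin : ∫⁻ s in Set.Ioc 0 τ, ‖f' s‖ₑ = ∞
  · rw [hfin]; exact le_top
  · have hint : IntervalIntegrable f' volume 0 τ := by
      rw [intervalIntegrable_iff_integrableOn_Ioc_of_le hτ]
      exact ⟨hm.aestronglyMeasurable, lt_top_iff_ne_top.2 hfin⟩
    rw [← intervalIntegral.integral_eq_sub_of_hasDerivAt (fun s _ => hf s) hint,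
      intervalIntegral.integral_of_le hτ]
    exact enorm_integral_le_lintegral_enorm _

/-- The second moment of the average of `m` independent centered vectors. -/
theorem lintegral_norm_sq_average_le {d m : ℕ} {X : Type*} [MeasurableSpace X] {ν : Measure X}
    [IsProbabilityMeasure ν] {Z : X → Vec d} (hZL : MemLp Z 2 ν)
    (hZ0 : ∀ v, ∫ x, inner ℝ (Z x) v ∂ν = 0) (hm : 1 ≤ m) :
    ∫⁻ s : Fin m → X, ‖(m : ℝ)⁻¹ • ∑ i, Z (s i)‖ₑ ^ 2 ∂(Measure.pi fun _ : Fin m => ν)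
      ≤ ENNReal.ofReal ((∫ x, ‖Z x‖ ^ 2 ∂ν) / m) := by
  have hm0 : (0 : ℝ) < m := by positivity
  have hZk : ∀ k, MemLp (fun x => Z x k) 2 ν := fun k =>
    hZL.of_le ((by fun_prop : Continuous fun v : Vec d => v k).comp_aestronglyMeasurable hZL.1)
      (Filter.Eventually.of_forall fun x => PiLp.norm_apply_le (Z x) k)
  have hZk0 : ∀ k, ∫ x, Z x k ∂ν = 0 := fun k => by
    have := hZ0 (EuclideanSpace.single k 1)
    simpa [EuclideanSpace.inner_single_right] using this
  have hZi : ∀ i, MemLp (fun s : Fin m → X => Z (s i)) 2 (Measure.pi fun _ : Fin m => ν) :=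
    fun i => hZL.comp_measurePreserving (measurePreserving_eval (fun _ : Fin m => ν) i)
  have hZki : ∀ k i, MemLp (fun s : Fin m → X => Z (s i) k) 2
      (Measure.pi fun _ : Fin m => ν) := fun k i =>
    (hZk k).comp_measurePreserving (measurePreserving_eval (fun _ : Fin m => ν) i)
  -- Independence is used coordinate by coordinate: for centered real variables the second moment is
  -- the variance, and variances of independent variables add up.
  have hsum : ∀ k, ∫ s : Fin m → X, (∑ i, Z (s i) k) ^ 2 ∂(Measure.pi fun _ : Fin m => ν)
      = m * ∫ x, Z x k ^ 2 ∂ν := by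
    intro k
    have hv := variance_sum_pi (ι := Fin m) (μ := fun _ => ν) (X := fun _ x => Z x k)
      fun _ => hZk k
    have hL : MemLp (∑ i : Fin m, fun s : Fin m → X => Z (s i) k) 2
        (Measure.pi fun _ : Fin m => ν) := memLp_finsetSum' _ fun i _ => hZki k i
    have hmean : ∫ s, (∑ i : Fin m, fun s : Fin m → X => Z (s i) k) s
        ∂(Measure.pi fun _ : Fin m => ν) = 0 := by
      simp only [Finset.sum_apply]
      rw [integral_finsetSum _ fun i _ => (hZki k i).integrable (by norm_num)]
      refine Finset.sum_eq_zero fun i _ => ?_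
      rw [integral_comp_eval (μ := fun _ : Fin m => ν) (i := i) (f := fun x => Z x k)
        (hZk k).1, hZk0]
    rw [variance_of_integral_eq_zero hL.1.aemeasurable hmean] at hv
    rw [variance_of_integral_eq_zero (hZk k).1.aemeasurable (hZk0 k)] at hv
    simpa using hv
  have hL : MemLp (fun s : Fin m → X => (m : ℝ)⁻¹ • ∑ i, Z (s i)) 2
      (Measure.pi fun _ : Fin m => ν) := by
    have h1 : MemLp (fun s : Fin m → X => ∑ i, Z (s i)) 2 (Measure.pi fun _ : Fin m => ν) :=
      memLp_finsetSum (Finset.univ : Finset (Fin m)) fun i _ => hZi i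
    exact h1.const_smul (m : ℝ)⁻¹
  have hLk : ∀ k, Integrable (fun s : Fin m → X => (∑ i, Z (s i) k) ^ 2)
      (Measure.pi fun _ : Fin m => ν) := fun k => by
    have h1 : MemLp (fun s : Fin m → X => ∑ i, Z (s i) k) 2 (Measure.pi fun _ : Fin m => ν) :=
      memLp_finsetSum (Finset.univ : Finset (Fin m)) fun i _ => hZki k i
    exact h1.integrable_sq
  rw [lintegral_enorm_sq_eq hL]
  refine le_of_eq (congrArg _ ?_)
  simp_rw [norm_smul, mul_pow, EuclideanSpace.real_norm_sq_eq]
  rw [integral_const_mul, integral_finsetSum _ fun k _ => (hZk k).integrable_sq]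
  simp only [WithLp.ofLp_sum, Finset.sum_apply]
  rw [integral_finsetSum _ fun k _ => hLk k]
  simp_rw [hsum]
  rw [← Finset.mul_sum]
  simp only [norm_inv, Real.norm_natCast]
  field_simp

/-! ### Unbiasedness of a single stochastic gradient -/

namespace LearningProblem

variable {h d : ℕ} {X : Type u} [MeasurableSpace X] {P : LearningProblem h d X} {L σ K : ℝ}

theorem Smooth.continuous_gradient (hS : P.Smooth L) (j : Fin h) :
    Continuous (∇ (P.localLoss j)) :=
  (LipschitzWith.of_dist_le' (K := L) fun x y => by
    rw [dist_eq_norm, dist_eq_norm]; exact hS.2 j x y).continuous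

theorem measurable_noise (hS : P.Smooth L) (j : Fin h) :
    Measurable fun p : Vec d × X => P.sampleGrad p.1 p.2 - ∇ (P.localLoss j) p.1 :=
  P.measurable_sampleGrad.sub ((hS.continuous_gradient j).measurable.comp measurable_fst)

theorem measurable_noise_left (hS : P.Smooth L) (j : Fin h) (θ : Vec d) :
    Measurable fun x : X => P.sampleGrad θ x - ∇ (P.localLoss j) θ :=
  Measurable.comp (g := fun p : Vec d × X => P.sampleGrad p.1 p.2 - ∇ (P.localLoss j) p.1)
    (f := fun x => (θ, x)) (measurable_noise hS j) measurable_prodMk_left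

theorem memLp_noise (hS : P.Smooth L) (hV : P.BoundedVariance σ) (j : Fin h) (θ : Vec d) :
    MemLp (fun x => P.sampleGrad θ x - ∇ (P.localLoss j) θ) 2 (P.D j) :=
  memLp_two_of_lintegral_enorm_sq_le (measurable_noise_left hS j θ).aestronglyMeasurable (hV j θ)

theorem hasDerivAt_centered (hS : P.Smooth L) (j : Fin h) (θ v : Vec d) (x : X) (s : ℝ) :
    HasDerivAt (fun s : ℝ => P.ℓ (θ + s • v) x - P.localLoss j (θ + s • v))
      (inner ℝ (P.sampleGrad (θ + s • v) x - ∇ (P.localLoss j) (θ + s • v)) v) s := by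
  have h1 : HasDerivAt (fun s : ℝ => θ + s • v) v s := by
    simpa using ((hasDerivAt_id s).smul_const v).const_add θ
  have h2 := ((P.differentiable_ℓ x) (θ + s • v)).hasGradientAt.hasFDerivAt.comp_hasDerivAt s h1
  have h3 := ((hS.1 j) (θ + s • v)).hasGradientAt.hasFDerivAt.comp_hasDerivAt s h1
  refine (h2.sub h3).congr_deriv ?_
  simp only [InnerProductSpace.toDual_apply_apply, inner_sub_left, sampleGrad]

/-- The increment of the centered loss is the integral of the directional noise along the segment.
Cauchy-Schwarz in the segment variable gives one factor `τ`; Tonelli and the variance bound at each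
point of the segment give the other. Hence difference quotients of the centered loss are bounded in
`L²`, uniformly in the step. -/
theorem lintegral_sq_centered_sub_le (hS : P.Smooth L) (hV : P.BoundedVariance σ) (j : Fin h)
    (θ v : Vec d) {τ : ℝ} (hτ : 0 ≤ τ) :
    ∫⁻ x, ‖(P.ℓ (θ + τ • v) x - P.localLoss j (θ + τ • v)) - (P.ℓ θ x - P.localLoss j θ)‖ₑ ^ 2
      ∂(P.D j) ≤ ENNReal.ofReal (τ ^ 2 * (σ ^ 2 * ‖v‖ ^ 2)) := by
  set φ : ℝ → X → ℝ := fun s x =>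
    inner ℝ (P.sampleGrad (θ + s • v) x - ∇ (P.localLoss j) (θ + s • v)) v with hφ
  have hφm : Measurable (Function.uncurry φ) := by
    have h1 : Measurable fun p : ℝ × X => (θ + p.1 • v, p.2) := by fun_prop
    have h2 := Measurable.comp
      (g := fun p : Vec d × X => P.sampleGrad p.1 p.2 - ∇ (P.localLoss j) p.1)
      (f := fun p : ℝ × X => (θ + p.1 • v, p.2)) (measurable_noise hS j) h1
    exact Measurable.inner_const (c := v) h2
  have hφs : ∀ x, Measurable fun s => φ s x := fun x =>
    Measurable.comp (g := Function.uncurry φ) (f := fun s => (s, x)) hφm measurable_prodMk_right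
  have hφb : ∀ s, ∫⁻ x, ‖φ s x‖ₑ ^ 2 ∂(P.D j) ≤ ENNReal.ofReal (σ ^ 2 * ‖v‖ ^ 2) := by
    intro s
    calc ∫⁻ x, ‖φ s x‖ₑ ^ 2 ∂(P.D j)
        ≤ ∫⁻ x, ‖P.sampleGrad (θ + s • v) x - ∇ (P.localLoss j) (θ + s • v)‖ₑ ^ 2 * ‖v‖ₑ ^ 2
            ∂(P.D j) := by
          refine lintegral_mono fun x => ?_
          rw [← mul_pow]
          gcongr
          rw [← ofReal_norm, ← ofReal_norm, ← ofReal_norm, ← ENNReal.ofReal_mul (norm_nonneg _)]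
          exact ENNReal.ofReal_le_ofReal (norm_inner_le_norm _ _)
      _ ≤ ENNReal.ofReal (σ ^ 2) * ‖v‖ₑ ^ 2 := by
          rw [lintegral_mul_const' _ _ (by simp)]
          gcongr
          exact hV j _
      _ = _ := by
          rw [ENNReal.ofReal_mul (by positivity), ENNReal.ofReal_pow (norm_nonneg _), ofReal_norm]
  calc ∫⁻ x, ‖(P.ℓ (θ + τ • v) x - P.localLoss j (θ + τ • v)) - (P.ℓ θ x - P.localLoss j θ)‖ₑ ^ 2
        ∂(P.D j)
      ≤ ∫⁻ x, (ENNReal.ofReal τ * ∫⁻ s in Set.Ioc 0 τ, ‖φ s x‖ₑ ^ 2) ∂(P.D j) := by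
        refine lintegral_mono fun x => ?_
        have h1 := enorm_sub_le_lintegral_of_hasDerivAt (hasDerivAt_centered hS j θ v x)
          (hφs x) hτ
        simp only [zero_smul, add_zero] at h1
        calc _ ≤ (∫⁻ s in Set.Ioc 0 τ, ‖φ s x‖ₑ) ^ 2 := by gcongr
          _ ≤ _ := sq_lintegral_le (hφs x).enorm.aemeasurable
          _ = _ := by simp
    _ = ENNReal.ofReal τ * ∫⁻ s in Set.Ioc 0 τ, ∫⁻ x, ‖φ s x‖ₑ ^ 2 ∂(P.D j) := by
        rw [lintegral_const_mul' _ _ ENNReal.ofReal_ne_top, lintegral_lintegral_swap]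
        exact ((hφm.comp measurable_swap).enorm.pow_const 2).aemeasurable
    _ ≤ ENNReal.ofReal τ * ∫⁻ s in Set.Ioc 0 τ, ENNReal.ofReal (σ ^ 2 * ‖v‖ ^ 2) := by
        gcongr with s; exact hφb s
    _ = _ := by
        rw [lintegral_const, Measure.restrict_apply_univ, Real.volume_Ioc, sub_zero,
          sq τ, ENNReal.ofReal_mul (p := τ * τ) (by positivity), ENNReal.ofReal_mul hτ]
        ring

/-- Stochastic gradients are unbiased. No domination is assumed: the difference quotients of the
centered loss are bounded in `L²`. -/
theorem integral_inner_noise (hS : P.Smooth L) (hV : P.BoundedVariance σ) (j : Fin h)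
    (θ v : Vec d) :
    ∫ x, inner ℝ (P.sampleGrad θ x - ∇ (P.localLoss j) θ) v ∂(P.D j) = 0 := by
  have hℓm : ∀ θ, Measurable (P.ℓ θ) := fun θ =>
    Measurable.comp (g := fun p : Vec d × X => P.ℓ p.1 p.2) (f := fun x => (θ, x))
      P.measurable_ℓ measurable_prodMk_left
  refine integral_eq_zero_of_tendsto_of_bounded_sq (a := σ ^ 2 * ‖v‖ ^ 2)
    (q := fun (n : ℕ) x => ((n : ℝ) + 1) *
      ((P.ℓ (θ + ((n : ℝ) + 1)⁻¹ • v) x - P.localLoss j (θ + ((n : ℝ) + 1)⁻¹ • v)) -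
        (P.ℓ θ x - P.localLoss j θ))) (by positivity) ?_ ?_ ?_ ?_ ?_
  · intro n
    exact (((hℓm _).sub_const _).sub ((hℓm _).sub_const _)).const_mul _
  · intro n
    have hn : (0 : ℝ) < (n : ℝ) + 1 := by positivity
    simp_rw [enorm_mul, mul_pow]
    rw [lintegral_const_mul' _ _ (by simp)]
    refine (mul_le_mul_right (lintegral_sq_centered_sub_le hS hV j θ v
      (inv_nonneg.2 hn.le)) _).trans_eq ?_
    rw [← ofReal_norm, ← ENNReal.ofReal_pow (norm_nonneg _),
      ← ENNReal.ofReal_mul (by positivity), Real.norm_of_nonneg hn.le]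
    congr 1
    field_simp
  -- Centered losses have mean zero at every parameter, hence so do their difference quotients.
  · intro n
    have h0 : ∀ θ, Integrable (fun x => P.ℓ θ x - P.localLoss j θ) (P.D j) := fun θ =>
      (P.integrable_ℓ j θ).sub (integrable_const _)
    have h1 : ∀ θ, ∫ x, (P.ℓ θ x - P.localLoss j θ) ∂(P.D j) = 0 := fun θ => by
      rw [integral_sub (P.integrable_ℓ j θ) (integrable_const _)]
      simp [localLoss]
    rw [integral_const_mul, integral_sub (h0 _) (h0 _), h1, h1]
    simp
  · intro x
    have hd := (hasDerivAt_centered hS j θ v x 0).hasFDerivAt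
    have hc : Filter.Tendsto (fun n : ℕ => ‖(n : ℝ) + 1‖) Filter.atTop Filter.atTop :=
      tendsto_norm_atTop_atTop.comp
        (Filter.tendsto_atTop_add_const_right _ _ tendsto_natCast_atTop_atTop)
    have := hd.lim 1 hc
    simpa using this
  · exact (memLp_noise hS hV j θ).inner_const v

/-! ### The noise of a batch -/

theorem stochGrad_sub_gradient {j : Fin h} {θ : Family h d} {m : ℕ} (hm : 1 ≤ m)
    (s : Batch h X m) :
    P.stochGrad m θ s j - ∇ (P.localLoss j) (θ j) =
      (m : ℝ)⁻¹ • ∑ i, (P.sampleGrad (θ j) (s j i) - ∇ (P.localLoss j) (θ j)) := by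
  have : (m : ℝ) ≠ 0 := by positivity
  rw [stochGrad, Finset.sum_sub_distrib, smul_sub]
  simp [← Nat.cast_smul_eq_nsmul ℝ, smul_smul, this]

theorem measurePreserving_batch (j : Fin h) (m : ℕ) :
    MeasurePreserving (fun s : Batch h X m => s j) (P.batchLaw m)
      (Measure.pi fun _ : Fin m => P.D j) :=
  measurePreserving_eval (fun j => Measure.pi fun _ : Fin m => P.D j) j

theorem measurePreserving_batch_draw (j : Fin h) {m : ℕ} (i : Fin m) :
    MeasurePreserving (fun s : Batch h X m => s j i) (P.batchLaw m) (P.D j) :=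
  (measurePreserving_eval (fun _ : Fin m => P.D j) i).comp (measurePreserving_batch j m)

theorem lintegral_batch_noise_le (hS : P.Smooth L) (hV : P.BoundedVariance σ) (j : Fin h)
    (θ : Family h d) {m : ℕ} (hm : 1 ≤ m) :
    ∫⁻ s, ‖P.stochGrad m θ s j - ∇ (P.localLoss j) (θ j)‖ₑ ^ 2 ∂(P.batchLaw m)
      ≤ ENNReal.ofReal (σ ^ 2 / m) := by
  have hZm := measurable_noise_left hS j (θ j)
  have hZL := memLp_noise hS hV j (θ j)
  have hZ0 := integral_inner_noise hS hV j (θ j)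
  have hZb := integral_norm_sq_le_of_lintegral hZm.aestronglyMeasurable (by positivity) (hV j (θ j))
  simp_rw [stochGrad_sub_gradient hm]
  generalize hZ : (fun x => P.sampleGrad (θ j) x - ∇ (P.localLoss j) (θ j)) = Z at *
  have hZx : ∀ x, P.sampleGrad (θ j) x - ∇ (P.localLoss j) (θ j) = Z x := fun x => by rw [← hZ]
  simp_rw [hZx] at *
  calc _ = ∫⁻ s : Fin m → X, ‖(m : ℝ)⁻¹ • ∑ i, Z (s i)‖ₑ ^ 2 ∂(Measure.pi fun _ : Fin m => P.D j) :=
        (measurePreserving_batch j m).lintegral_comp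
          (f := fun s : Fin m → X => ‖(m : ℝ)⁻¹ • ∑ i, Z (s i)‖ₑ ^ 2) (by fun_prop)
    _ ≤ ENNReal.ofReal ((∫ x, ‖Z x‖ ^ 2 ∂(P.D j)) / m) :=
        lintegral_norm_sq_average_le hZL hZ0 hm
    _ ≤ _ := by
        refine ENNReal.ofReal_le_ofReal ?_
        gcongr

theorem integral_inner_batch_noise (hS : P.Smooth L) (hV : P.BoundedVariance σ) (j : Fin h)
    (θ : Family h d) {m : ℕ} (hm : 1 ≤ m) (v : Vec d) :
    ∫ s, inner ℝ (P.stochGrad m θ s j - ∇ (P.localLoss j) (θ j)) v ∂(P.batchLaw m) = 0 := by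
  have hL : MemLp (fun x => inner ℝ (P.sampleGrad (θ j) x - ∇ (P.localLoss j) (θ j)) v) 2 (P.D j) :=
    (memLp_noise hS hV j (θ j)).inner_const v
  have hLi : ∀ i, MemLp (fun s : Batch h X m =>
      inner ℝ (P.sampleGrad (θ j) (s j i) - ∇ (P.localLoss j) (θ j)) v) 2 (P.batchLaw m) := fun i =>
    hL.comp_measurePreserving (measurePreserving_batch_draw j i)
  simp_rw [stochGrad_sub_gradient hm, real_inner_smul_left, sum_inner (𝕜 := ℝ)]
  rw [integral_const_mul, integral_finsetSum _ fun i _ => (hLi i).integrable (by norm_num)]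
  refine mul_eq_zero_of_right _ (Finset.sum_eq_zero fun i _ => ?_)
  have hmp := measurePreserving_batch_draw (P := P) j (m := m) i
  rw [← integral_inner_noise hS hV j (θ j) v, ← hmp.map_eq,
    integral_map hmp.measurable.aemeasurable (by rw [hmp.map_eq]; exact hL.1)]

end LearningProblem

/-! ### The average loss -/

namespace LearningProblem

variable {h d : ℕ} {X : Type u} [MeasurableSpace X] {P : LearningProblem h d X} {L σ K C : ℝ}

variable (P) in
/-- The gradients of the local losses, each at the parameter of its node. -/
noncomputable def localGrad (θ : Family h d) : Family h d := fun j => ∇ (P.localLoss j) (θ j)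

theorem Smooth.hasGradientAt_avgLoss (hS : P.Smooth L) (θ : Vec d) :
    HasGradientAt P.avgLoss (mean (P.localGrad fun _ => θ)) θ := by
  have h1 : HasFDerivAt P.avgLoss ((h : ℝ)⁻¹ • ∑ j, InnerProductSpace.toDual ℝ (Vec d)
      (∇ (P.localLoss j) θ)) θ :=
    (HasFDerivAt.fun_sum fun j _ => ((hS.1 j) θ).hasGradientAt.hasFDerivAt).const_mul _
  refine h1.congr_fderiv ?_
  simp [mean, localGrad]

theorem Smooth.gradient_avgLoss (hS : P.Smooth L) (θ : Vec d) :
    ∇ P.avgLoss θ = mean (P.localGrad fun _ => θ) :=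
  (hS.hasGradientAt_avgLoss θ).gradient

theorem Smooth.differentiable_avgLoss (hS : P.Smooth L) : Differentiable ℝ P.avgLoss :=
  fun θ => (hS.hasGradientAt_avgLoss θ).hasFDerivAt.differentiableAt

theorem Smooth.gradient_avgLoss_sub_le (hS : P.Smooth L) (hL : 0 ≤ L) (θ θ' : Vec d) :
    ‖∇ P.avgLoss θ - ∇ P.avgLoss θ'‖ ≤ L * ‖θ - θ'‖ := by
  rw [hS.gradient_avgLoss, hS.gradient_avgLoss, ← mean_sub]
  exact norm_mean_le (by positivity) fun j => hS.2 j θ θ'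

theorem Smooth.continuous_gradient_avgLoss (hS : P.Smooth L) (hL : 0 ≤ L) :
    Continuous (∇ P.avgLoss) :=
  (LipschitzWith.of_dist_le' (K := L) fun x y => by
    rw [dist_eq_norm, dist_eq_norm]; exact hS.gradient_avgLoss_sub_le hL x y).continuous

theorem Smooth.norm_mean_localGrad_sub_le (hS : P.Smooth L) (hL : 0 ≤ L) (hh : 0 < h)
    (θ : Family h d) :
    ‖mean (P.localGrad θ) - ∇ P.avgLoss (mean θ)‖ ≤ L * diameter θ := by
  rw [hS.gradient_avgLoss, ← mean_sub]
  refine norm_mean_le (by positivity) fun j => (hS.2 j _ _).trans ?_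
  gcongr
  exact norm_sub_mean_le hh θ j

theorem Smooth.measurable_localGrad (hS : P.Smooth L) : Measurable P.localGrad :=
  measurable_pi_lambda _ fun j =>
    (hS.continuous_gradient j).measurable.comp (measurable_pi_apply j)

theorem Nonneg.avgLoss (hP : P.Nonneg) (θ : Vec d) : 0 ≤ P.avgLoss θ :=
  mul_nonneg (by positivity) (Finset.sum_nonneg fun j _ => hP j θ)

theorem InitialLossLE.avgLoss {θ : Vec d} {Lmax : ℝ} (hP : P.InitialLossLE θ Lmax) (hh : 0 < h) :
    P.avgLoss θ ≤ Lmax := by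
  have : ∑ j, P.localLoss j θ ≤ h * Lmax := by
    refine (Finset.sum_le_sum fun j _ => hP j).trans ?_
    simp
  rw [LearningProblem.avgLoss, inv_mul_le_iff₀ (by positivity)]
  exact this

theorem IsHeterogeneity.norm_sub_le (hK : P.IsHeterogeneity K) (j k : Fin h) (θ : Vec d) :
    ‖∇ (P.localLoss j) θ - ∇ (P.localLoss k) θ‖ ≤ K := hK.1 ⟨j, k, θ, rfl⟩

/-- A non-negative function with constant gradient is constant, so that heterogeneous smooth losses
have a positive smoothness constant. -/
theorem IsHeterogeneity.smooth_pos (hK : P.IsHeterogeneity K) (hK0 : 0 < K) (hP : P.Nonneg)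
    (hS : P.Smooth L) : 0 < L := by
  by_contra! hL
  have hconst : ∀ j θ θ', ∇ (P.localLoss j) θ = ∇ (P.localLoss j) θ' := fun j θ θ' => by
    rw [← sub_eq_zero, ← norm_le_zero_iff]
    exact (hS.2 j θ θ').trans (mul_nonpos_of_nonpos_of_nonneg hL (norm_nonneg _))
  have hzero : ∀ j θ, ∇ (P.localLoss j) θ = 0 := by
    intro j θ
    by_contra hne
    have hpos : 0 < ‖∇ (P.localLoss j) θ‖ ^ 2 := by positivity
    -- With this step length the upper model of the descent lemma (with smoothness constant 0)
    -- equals -1, which contradicts non-negativity.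
    set a := (P.localLoss j θ + 1) / ‖∇ (P.localLoss j) θ‖ ^ 2 with ha
    have h1 := le_add_inner_add_of_lipschitz_gradient (L := 0) (hS.1 j)
      (fun x y => by rw [hconst j x y]; simp) θ (θ - a • ∇ (P.localLoss j) θ)
    have h2 := hP j (θ - a • ∇ (P.localLoss j) θ)
    rw [sub_sub_cancel_left, inner_neg_right, real_inner_smul_right, real_inner_self_eq_norm_sq,
      ha, div_mul_cancel₀ _ hpos.ne'] at h1
    linarith
  have : K ≤ 0 := hK.2 fun r ⟨j, k, θ, hr⟩ => by rw [hr, hzero, hzero]; simp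
  linarith

/-- Without nodes the set of gradient differences is empty; every real number is then an upper
bound, and there is no least one. -/
theorem IsHeterogeneity.card_pos (hK : P.IsHeterogeneity K) : 0 < h := by
  by_contra! h0
  obtain rfl : h = 0 := by omega
  have : K ≤ K - 1 := hK.2 fun r ⟨j, _⟩ => j.elim0
  linarith

end LearningProblem

/-! ### Pointwise estimates -/

section Pointwise

variable {E : Type*} [NormedAddCommGroup E] [InnerProductSpace ℝ E]

theorem add_sq_le_weighted (a b : ℝ) {κ : ℝ} (hκ : 0 < κ) :
    (a + b) ^ 2 ≤ (1 + κ) * a ^ 2 + (1 + 1 / κ) * b ^ 2 := by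
  have h1 : (1 + κ) * a ^ 2 + (1 + 1 / κ) * b ^ 2 - (a + b) ^ 2 = (κ * a - b) ^ 2 / κ := by
    field_simp; ring
  have h2 : 0 ≤ (κ * a - b) ^ 2 / κ := by positivity
  linarith

theorem norm_add_sq_le_weighted {E : Type*} [NormedAddCommGroup E] (a b : E) {κ : ℝ} (hκ : 0 < κ) :
    ‖a + b‖ ^ 2 ≤ (1 + κ) * ‖a‖ ^ 2 + (1 + 1 / κ) * ‖b‖ ^ 2 :=
  (pow_le_pow_left₀ (norm_nonneg _) (norm_add_le a b) 2).trans (add_sq_le_weighted _ _ hκ)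

theorem neg_inner_le_weighted (a b : E) {κ : ℝ} (hκ : 0 < κ) :
    -inner ℝ a b ≤ κ / 2 * ‖a‖ ^ 2 + 1 / (2 * κ) * ‖b‖ ^ 2 := by
  have h1 := neg_le_of_abs_le (abs_real_inner_le_norm a b)
  have h2 : κ / 2 * ‖a‖ ^ 2 + 1 / (2 * κ) * ‖b‖ ^ 2 - ‖a‖ * ‖b‖
      = (κ * ‖a‖ - ‖b‖) ^ 2 / (2 * κ) := by
    field_simp; ring
  have h3 : 0 ≤ (κ * ‖a‖ - ‖b‖) ^ 2 / (2 * κ) := by positivity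
  linarith

/-- Decrease of a smooth function in a step along a perturbed gradient; the part `n` of the
perturbation is only paid for to second order. -/
theorem perturbed_gradient_step [CompleteSpace E] {f : E → ℝ} {L η δ : ℝ}
    (hf : Differentiable ℝ f) (hL : ∀ x y, ‖∇ f x - ∇ f y‖ ≤ L * ‖x - y‖) (hη : 0 < η)
    (hδ : 0 < δ) (hδ3 : δ < 3) (hLη : L * η = δ / 12) (x p q n s : E) :
    f (x - η • (∇ f x + p + q + n - s)) - f x + η * inner ℝ (∇ f x) n ≤
      η * (-(1 / 2 - δ / 8) * ‖∇ f x‖ ^ 2 + (1 / 2 + 5 * δ / 48) * ‖p‖ ^ 2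
        + 30 / δ * (‖q‖ ^ 2 + ‖s‖ ^ 2) + 5 * δ / 8 * ‖n‖ ^ 2) := by
  have h0 := le_add_inner_add_of_lipschitz_gradient hf hL x (x - η • (∇ f x + p + q + n - s))
  set y := ∇ f x
  rw [sub_sub_cancel_left, inner_neg_right, norm_neg, norm_smul, Real.norm_of_nonneg hη.le,
    mul_pow, real_inner_smul_right] at h0
  have e1 : inner ℝ y (y + p + q + n - s)
      = ‖y‖ ^ 2 + inner ℝ y p + inner ℝ y (q - s) + inner ℝ y n := by
    simp only [inner_add_right, inner_sub_right, real_inner_self_eq_norm_sq]; ring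
  have e2 : L / 2 * (η ^ 2 * ‖y + p + q + n - s‖ ^ 2)
      = η * (δ / 24 * ‖y + p + q + n - s‖ ^ 2) := by
    linear_combination (η / 2 * ‖y + p + q + n - s‖ ^ 2) * hLη
  rw [e1, e2] at h0
  -- Weight one is what keeps the coefficients of `‖y‖²` and `‖p‖²` both at 1/2 to leading order, so
  -- that the limiting bound is exactly `C²K²`.
  have i1 := neg_inner_le_weighted y p one_pos
  -- This weight costs only `δ/48 · ‖y‖²`; the price is the factor `1/δ` on `q` and `s`. Together
  -- with `5δ/48` from the second-order term this makes the loss of `δ/8`.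
  have i2 := neg_inner_le_weighted y (q - s) (κ := δ / 24) (by positivity)
  have i3 := norm_add_sq_le_weighted q (-s) one_pos
  rw [← sub_eq_add_neg, norm_neg] at i3
  have i4 := norm_add_sq_le_weighted (y + p) (q + n - s) (κ := 1 / 4) (by norm_num)
  rw [show y + p + (q + n - s) = y + p + q + n - s by abel] at i4
  have i5 := norm_add_sq_le_weighted y p one_pos
  have i6 := norm_add_sq_le_weighted n (q - s) (κ := 2) (by norm_num)
  rw [show n + (q - s) = q + n - s by abel] at i6
  have i7 : ‖y + p + q + n - s‖ ^ 2 ≤ 5 / 2 * (‖y‖ ^ 2 + ‖p‖ ^ 2)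
      + 15 * (‖n‖ ^ 2 + ‖q‖ ^ 2 + ‖s‖ ^ 2) := by linarith
  have i8 := mul_le_mul_of_nonneg_left i7 (by positivity : (0 : ℝ) ≤ δ / 24)
  have i9 : 1 / (2 * (δ / 24)) * ‖q - s‖ ^ 2 ≤ 24 / δ * (‖q‖ ^ 2 + ‖s‖ ^ 2) := by
    have : 1 / (2 * (δ / 24)) = 12 / δ := by field_simp; norm_num
    rw [this]
    have := mul_le_mul_of_nonneg_left i3 (by positivity : (0 : ℝ) ≤ 12 / δ)
    refine this.trans (le_of_eq ?_)
    field_simp; ring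
  have i10 : 5 * δ / 8 * (‖q‖ ^ 2 + ‖s‖ ^ 2) ≤ 6 / δ * (‖q‖ ^ 2 + ‖s‖ ^ 2) := by
    refine mul_le_mul_of_nonneg_right ?_ (by positivity)
    rw [div_le_div_iff₀ (by norm_num) hδ]
    nlinarith
  have i11 : 30 / δ * (‖q‖ ^ 2 + ‖s‖ ^ 2)
      = 24 / δ * (‖q‖ ^ 2 + ‖s‖ ^ 2) + 6 / δ * (‖q‖ ^ 2 + ‖s‖ ^ 2) := by ring
  have i12 : -(‖y‖ ^ 2 + inner ℝ y p + inner ℝ y (q - s))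
      + δ / 24 * ‖y + p + q + n - s‖ ^ 2 ≤ -(1 / 2 - δ / 8) * ‖y‖ ^ 2
        + (1 / 2 + 5 * δ / 48) * ‖p‖ ^ 2
        + 30 / δ * (‖q‖ ^ 2 + ‖s‖ ^ 2) + 5 * δ / 8 * ‖n‖ ^ 2 := by
    rw [i11]
    linarith
  have := mul_le_mul_of_nonneg_left i12 hη.le
  linarith

end Pointwise

/-- Compare both local gradients at the common point `θ k`: this costs the heterogeneity `K`, the
drift `L * diameter θ`, and the noise. The free weight `κ` keeps the coefficient of `K²` close to 1.
-/
theorem LearningProblem.diameter_sq_le {h d : ℕ} {X : Type u} [MeasurableSpace X]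
    {P : LearningProblem h d X} {L K : ℝ} (hS : P.Smooth L) (hL : 0 ≤ L)
    (hK : P.IsHeterogeneity K) (hK0 : 0 ≤ K) (θ g : Family h d) {κ : ℝ} (hκ : 0 < κ) :
    (diameter g : ℝ) ^ 2 ≤ (1 + κ) * K ^ 2 + (1 + 1 / κ) *
      (2 * L ^ 2 * (diameter θ : ℝ) ^ 2 + 8 * ∑ j, ‖(g - P.localGrad θ) j‖ ^ 2) := by
  have h1 : (diameter g : ℝ) ≤ K + (L * diameter θ + diameter (g - P.localGrad θ)) := by
    refine diameter_le (by positivity) fun j k => ?_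
    have e : g j - g k = (∇ (P.localLoss j) (θ k) - ∇ (P.localLoss k) (θ k))
        + ((∇ (P.localLoss j) (θ j) - ∇ (P.localLoss j) (θ k))
          + ((g - P.localGrad θ) j - (g - P.localGrad θ) k)) := by
      simp only [Pi.sub_apply, localGrad]; abel
    rw [e]
    refine (norm_add_le _ _).trans (add_le_add (hK.norm_sub_le j k _) ?_)
    refine (norm_add_le _ _).trans (add_le_add ?_ (norm_sub_le_diameter _ j k))
    refine (hS.2 j _ _).trans ?_
    gcongr
    exact norm_sub_le_diameter θ j k
  have h2 := diameter_sq_le_sum (g - P.localGrad θ)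
  calc (diameter g : ℝ) ^ 2 ≤ (K + (L * diameter θ + diameter (g - P.localGrad θ))) ^ 2 := by
        gcongr
    _ ≤ _ := add_sq_le_weighted _ _ hκ
    _ ≤ _ := by
        gcongr
        nlinarith [sq_nonneg (L * diameter θ - diameter (g - P.localGrad θ))]

/-! ### One iteration -/

section Step

variable {Ω : Type*} [MeasurableSpace Ω] {h d : ℕ} {X : Type u} [MeasurableSpace X]

theorem enorm_coe_diameter (x : Family h d) : ‖(diameter x : ℝ)‖ₑ = (diameter x : ℝ≥0∞) := by
  rw [Real.enorm_eq_ofReal (NNReal.coe_nonneg _), ENNReal.ofReal_coe_nnreal]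

theorem lintegral_diameter_sq_eq {ρ : Measure Ω} {x : Ω → Family h d}
    (hx : MemLp (fun ω => (diameter (x ω) : ℝ)) 2 ρ) :
    ∫⁻ ω, (diameter (x ω) : ℝ≥0∞) ^ 2 ∂ρ
      = ENNReal.ofReal (∫ ω, (diameter (x ω) : ℝ) ^ 2 ∂ρ) := by
  have := lintegral_enorm_sq_eq hx
  simpa [enorm_coe_diameter] using this

theorem memLp_diameter_of_lintegral_le {ρ : Measure Ω} {x : Ω → Family h d} (hx : Measurable x)
    {a : ℝ} (ha : 0 ≤ a)
    (hle : ∫⁻ ω, (diameter (x ω) : ℝ≥0∞) ^ 2 ∂ρ ≤ ENNReal.ofReal a) :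
    MemLp (fun ω => (diameter (x ω) : ℝ)) 2 ρ ∧ ∫ ω, (diameter (x ω) : ℝ) ^ 2 ∂ρ ≤ a := by
  have hm : AEStronglyMeasurable (fun ω => (diameter (x ω) : ℝ)) ρ :=
    (measurable_diameter.comp hx).coe_nnreal_real.aestronglyMeasurable
  simp_rw [← enorm_coe_diameter] at hle
  refine ⟨memLp_two_of_lintegral_enorm_sq_le hm hle, ?_⟩
  simpa using integral_norm_sq_le_of_lintegral hm ha hle

/-- What the analysis of `Learn` uses about one iteration: `θ` are the parameters at its beginning,
`g` the stochastic gradients, `γ` their agreed version, and `φ` the parameters at its end. -/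
structure IsLearnStep (P : LearningProblem h d X) (C σ η : ℝ) (m t : ℕ) (ρ : Measure Ω)
    (θ g γ φ : Ω → Family h d) : Prop where
  measurable_θ : Measurable θ
  measurable_g : Measurable g
  measurable_γ : Measurable γ
  measurable_φ : Measurable φ
  noise : ∀ j, ∫⁻ ω, ‖(g ω - P.localGrad (θ ω)) j‖ₑ ^ 2 ∂ρ ≤ ENNReal.ofReal (σ ^ 2 / m)
  unbiased : ∫ ω, inner ℝ (∇ P.avgLoss (mean (θ ω))) (mean (g ω - P.localGrad (θ ω)))
    ∂ρ = 0
  diameter_γ : ∫⁻ ω, (diameter (γ ω) : ℝ≥0∞) ^ 2 ∂ρ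
    ≤ (∫⁻ ω, (diameter (g ω) : ℝ≥0∞) ^ 2 ∂ρ) / 4 ^ agreementLevel t
  mean_γ : ∫⁻ ω, ‖mean (γ ω) - mean (g ω)‖ₑ ^ 2 ∂ρ
    ≤ ENNReal.ofReal (C ^ 2) * ∫⁻ ω, (diameter (g ω) : ℝ≥0∞) ^ 2 ∂ρ
  diameter_φ : ∫⁻ ω, (diameter (φ ω) : ℝ≥0∞) ^ 2 ∂ρ
    ≤ (∫⁻ ω, (diameter (θ ω - η • γ ω) : ℝ≥0∞) ^ 2 ∂ρ) / 4 ^ 1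
  mean_φ : ∫⁻ ω, ‖mean (φ ω) - mean (θ ω - η • γ ω)‖ₑ ^ 2 ∂ρ
    ≤ ENNReal.ofReal (C ^ 2) * ∫⁻ ω, (diameter (θ ω - η • γ ω) : ℝ≥0∞) ^ 2 ∂ρ

/-- This is the reason for the level `⌈log₂ t⌉`: the contraction factor of iteration `t` becomes
summable in `t`. -/
theorem sq_le_four_pow_agreementLevel {t : ℕ} (ht : 1 ≤ t) :
    (t : ℝ) ^ 2 ≤ 4 ^ agreementLevel t := by
  have ht0 : (0 : ℝ) < t := by positivity
  have h1 : (t : ℝ) ≤ 2 ^ agreementLevel t := by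
    have := Nat.le_ceil (Real.logb 2 t)
    rw [Real.logb_le_iff_le_rpow (by norm_num) ht0, Real.rpow_natCast] at this
    exact this
  calc (t : ℝ) ^ 2 ≤ (2 ^ agreementLevel t) ^ 2 := by gcongr
    _ = 4 ^ agreementLevel t := by rw [← pow_mul, mul_comm, pow_mul]; norm_num

/-- A smooth non-negative function is integrable along square integrable arguments. -/
theorem integrable_comp_of_lipschitz_gradient {E : Type*} [NormedAddCommGroup E]
    [InnerProductSpace ℝ E] [CompleteSpace E] {f : E → ℝ} {L : ℝ} (hf : Differentiable ℝ f)
    (hL : ∀ x y, ‖∇ f x - ∇ f y‖ ≤ L * ‖x - y‖) (h0 : ∀ x, 0 ≤ f x) {ρ : Measure Ω}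
    [IsProbabilityMeasure ρ] {Y : Ω → E} (hY : MemLp Y 2 ρ) : Integrable (fun ω => f (Y ω)) ρ := by
  have hb : Integrable (fun ω => f 0 + ‖∇ f 0‖ * ‖Y ω‖ + L / 2 * ‖Y ω‖ ^ 2) ρ :=
    ((integrable_const _).add ((hY.integrable (by norm_num)).norm.const_mul _)).add
      ((hY.integrable_norm_pow two_ne_zero).const_mul _)
  refine hb.mono' (hf.continuous.comp_aestronglyMeasurable hY.1)
    (Filter.Eventually.of_forall fun ω => ?_)
  rw [Real.norm_of_nonneg (h0 _)]
  have h1 := le_add_inner_add_of_lipschitz_gradient hf hL 0 (Y ω)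
  rw [sub_zero] at h1
  have h2 := real_inner_le_norm (∇ f 0) (Y ω)
  linarith

theorem integrable_inner_of_memLp {E : Type*} [NormedAddCommGroup E] [InnerProductSpace ℝ E]
    {ρ : Measure Ω} {Y Z : Ω → E} (hY : MemLp Y 2 ρ) (hZ : MemLp Z 2 ρ) :
    Integrable (fun ω => inner ℝ (Y ω) (Z ω)) ρ :=
  (hY.norm.integrable_mul hZ.norm).mono' (hY.1.inner hZ.1)
    (Filter.Eventually.of_forall fun _ => norm_inner_le_norm _ _)

theorem memLp_comp_of_lipschitz {E F : Type*} [NormedAddCommGroup E] [NormedAddCommGroup F]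
    {f : E → F} {L : ℝ} (hL : ∀ x y, ‖f x - f y‖ ≤ L * ‖x - y‖) {ρ : Measure Ω}
    [IsProbabilityMeasure ρ] {Y : Ω → E} (hY : MemLp Y 2 ρ) : MemLp (fun ω => f (Y ω)) 2 ρ := by
  have hc : Continuous f := (LipschitzWith.of_dist_le' (K := L) fun x y => by
    rw [dist_eq_norm, dist_eq_norm]; exact hL x y).continuous
  have hb : MemLp (fun ω => ‖f 0‖ + L * ‖Y ω‖) 2 ρ := by
    have h1 : MemLp (fun ω => L * ‖Y ω‖) 2 ρ := hY.norm.const_mul L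
    exact (memLp_const ‖f 0‖).add h1
  refine hb.of_le (hc.comp_aestronglyMeasurable hY.1) (Filter.Eventually.of_forall fun ω => ?_)
  have h1 := hL (Y ω) 0
  rw [sub_zero] at h1
  have h2 := norm_le_norm_add_norm_sub' (f (Y ω)) (f 0)
  exact (by linarith : _ ≤ ‖f 0‖ + L * ‖Y ω‖).trans (le_abs_self _)

/-! ### Moment bounds for one iteration -/

namespace IsLearnStep

variable {P : LearningProblem h d X} {L K C σ η : ℝ} {m t : ℕ} {ρ : Measure Ω}
  {θ g γ φ : Ω → Family h d}

theorem memLp_noise (hs : IsLearnStep P C σ η m t ρ θ g γ φ) (hS : P.Smooth L) (j : Fin h) :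
    MemLp (fun ω => (g ω - P.localGrad (θ ω)) j) 2 ρ :=
  memLp_two_of_lintegral_enorm_sq_le ((measurable_pi_apply j).comp
    (hs.measurable_g.sub (hS.measurable_localGrad.comp hs.measurable_θ))).aestronglyMeasurable
    (hs.noise j)

theorem integral_noise_le (hs : IsLearnStep P C σ η m t ρ θ g γ φ) (hS : P.Smooth L) :
    Integrable (fun ω => ∑ j, ‖(g ω - P.localGrad (θ ω)) j‖ ^ 2) ρ ∧
    ∫ ω, ∑ j, ‖(g ω - P.localGrad (θ ω)) j‖ ^ 2 ∂ρ ≤ h * (σ ^ 2 / m) := by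
  have hi : ∀ j ∈ Finset.univ, Integrable (fun ω => ‖(g ω - P.localGrad (θ ω)) j‖ ^ 2) ρ :=
    fun j _ => (hs.memLp_noise hS j).integrable_norm_pow two_ne_zero
  refine ⟨integrable_finsetSum _ hi, ?_⟩
  rw [integral_finsetSum _ hi]
  refine (Finset.sum_le_sum fun j _ => integral_norm_sq_le_of_lintegral
    (hs.memLp_noise hS j).1 (by positivity) (hs.noise j)).trans_eq ?_
  simp

theorem diameter_g_le [IsProbabilityMeasure ρ] (hs : IsLearnStep P C σ η m t ρ θ g γ φ) (hS : P.Smooth L) (hL : 0 ≤ L)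
    (hK : P.IsHeterogeneity K) (hK0 : 0 ≤ K)
    (hθ : MemLp (fun ω => (diameter (θ ω) : ℝ)) 2 ρ) :
    MemLp (fun ω => (diameter (g ω) : ℝ)) 2 ρ ∧ ∀ κ : ℝ, 0 < κ →
    ∫ ω, (diameter (g ω) : ℝ) ^ 2 ∂ρ ≤ (1 + κ) * K ^ 2 + (1 + 1 / κ) *
      (2 * L ^ 2 * ∫ ω, (diameter (θ ω) : ℝ) ^ 2 ∂ρ + 8 * (h * (σ ^ 2 / m))) := by
  obtain ⟨hi, hle⟩ := hs.integral_noise_le hS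
  have h1 : Integrable (fun ω => 2 * L ^ 2 * (diameter (θ ω) : ℝ) ^ 2) ρ :=
    hθ.integrable_sq.const_mul _
  have h2 : Integrable (fun ω => 8 * ∑ j, ‖(g ω - P.localGrad (θ ω)) j‖ ^ 2) ρ := hi.const_mul 8
  have hb : ∀ κ : ℝ, Integrable (fun ω => (1 + κ) * K ^ 2 + (1 + 1 / κ) *
      (2 * L ^ 2 * (diameter (θ ω) : ℝ) ^ 2 + 8 * ∑ j, ‖(g ω - P.localGrad (θ ω)) j‖ ^ 2)) ρ :=
    fun κ => (integrable_const _).add ((h1.add h2).const_mul _)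
  have hm : AEStronglyMeasurable (fun ω => (diameter (g ω) : ℝ)) ρ :=
    (measurable_diameter.comp hs.measurable_g).coe_nnreal_real.aestronglyMeasurable
  have hpt : ∀ (κ : ℝ), 0 < κ → ∀ ω, (diameter (g ω) : ℝ) ^ 2 ≤ (1 + κ) * K ^ 2 + (1 + 1 / κ) *
      (2 * L ^ 2 * (diameter (θ ω) : ℝ) ^ 2 + 8 * ∑ j, ‖(g ω - P.localGrad (θ ω)) j‖ ^ 2) :=
    fun κ hκ ω => LearningProblem.diameter_sq_le hS hL hK hK0 (θ ω) (g ω) hκ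
  -- Any fixed weight gives integrability; the choice of `κ` matters only for the size of the bound.
  have hsq : Integrable (fun ω => (diameter (g ω) : ℝ) ^ 2) ρ :=
    (hb 1).mono' (hm.pow 2) (Filter.Eventually.of_forall fun ω => by
      rw [Real.norm_of_nonneg (by positivity)]; exact hpt 1 one_pos ω)
  refine ⟨(memLp_two_iff_integrable_sq hm).2 hsq, fun κ hκ => ?_⟩
  calc _ ≤ ∫ ω, ((1 + κ) * K ^ 2 + (1 + 1 / κ) * (2 * L ^ 2 * (diameter (θ ω) : ℝ) ^ 2
        + 8 * ∑ j, ‖(g ω - P.localGrad (θ ω)) j‖ ^ 2)) ∂ρ := integral_mono hsq (hb κ) (hpt κ hκ)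
    _ = (1 + κ) * K ^ 2 + (1 + 1 / κ) * (2 * L ^ 2 * ∫ ω, (diameter (θ ω) : ℝ) ^ 2 ∂ρ
        + 8 * ∫ ω, ∑ j, ‖(g ω - P.localGrad (θ ω)) j‖ ^ 2 ∂ρ) := by
      have e1 := integral_add (integrable_const ((1 + κ) * K ^ 2) (μ := ρ))
        ((h1.add h2).const_mul (1 + 1 / κ))
      have e2 := integral_add h1 h2
      simp only [Pi.add_apply] at e1
      rw [e1, integral_const_mul (1 + 1 / κ), e2, integral_const_mul (2 * L ^ 2),
        integral_const_mul (8 : ℝ)]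
      simp
    _ ≤ _ := by gcongr

theorem diameter_γ_le (hs : IsLearnStep P C σ η m t ρ θ g γ φ) (ht : 1 ≤ t)
    (hg : MemLp (fun ω => (diameter (g ω) : ℝ)) 2 ρ) :
    MemLp (fun ω => (diameter (γ ω) : ℝ)) 2 ρ ∧
    ∫ ω, (diameter (γ ω) : ℝ) ^ 2 ∂ρ ≤ (∫ ω, (diameter (g ω) : ℝ) ^ 2 ∂ρ) / t ^ 2 := by
  have h0 : 0 ≤ ∫ ω, (diameter (g ω) : ℝ) ^ 2 ∂ρ := integral_nonneg fun ω => by positivity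
  refine memLp_diameter_of_lintegral_le hs.measurable_γ (by positivity) (hs.diameter_γ.trans ?_)
  rw [lintegral_diameter_sq_eq hg,
    show (4 : ℝ≥0∞) ^ agreementLevel t = ENNReal.ofReal (4 ^ agreementLevel t) by
      rw [ENNReal.ofReal_pow (by norm_num)]; norm_num, ← ENNReal.ofReal_div_of_pos (by positivity)]
  refine ENNReal.ofReal_le_ofReal ?_
  gcongr
  exact sq_le_four_pow_agreementLevel ht

theorem diameter_half_le (hs : IsLearnStep P C σ η m t ρ θ g γ φ) (hη : 0 ≤ η)
    (hθ : MemLp (fun ω => (diameter (θ ω) : ℝ)) 2 ρ)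
    (hγ : MemLp (fun ω => (diameter (γ ω) : ℝ)) 2 ρ) :
    MemLp (fun ω => (diameter (θ ω - η • γ ω) : ℝ)) 2 ρ ∧
    ∫ ω, (diameter (θ ω - η • γ ω) : ℝ) ^ 2 ∂ρ
      ≤ 2 * ∫ ω, (diameter (θ ω) : ℝ) ^ 2 ∂ρ + 2 * η ^ 2 * ∫ ω, (diameter (γ ω) : ℝ) ^ 2 ∂ρ := by
  have hm : AEStronglyMeasurable (fun ω => (diameter (θ ω - η • γ ω) : ℝ)) ρ :=
    (measurable_diameter.comp (hs.measurable_θ.sub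
      (hs.measurable_γ.const_smul η))).coe_nnreal_real.aestronglyMeasurable
  have h1 : Integrable (fun ω => 2 * (diameter (θ ω) : ℝ) ^ 2) ρ := hθ.integrable_sq.const_mul _
  have h2 : Integrable (fun ω => 2 * η ^ 2 * (diameter (γ ω) : ℝ) ^ 2) ρ :=
    hγ.integrable_sq.const_mul _
  have hpt : ∀ ω, (diameter (θ ω - η • γ ω) : ℝ) ^ 2
      ≤ 2 * (diameter (θ ω) : ℝ) ^ 2 + 2 * η ^ 2 * (diameter (γ ω) : ℝ) ^ 2 := fun ω => by
    have h3 := pow_le_pow_left₀ (NNReal.coe_nonneg _) (diameter_sub_smul_le (θ ω) (γ ω) hη) 2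
    have h4 := add_sq_le_weighted (diameter (θ ω)) (η * diameter (γ ω)) one_pos
    linarith
  have hsq : Integrable (fun ω => (diameter (θ ω - η • γ ω) : ℝ) ^ 2) ρ :=
    (h1.add h2).mono' (hm.pow 2) (Filter.Eventually.of_forall fun ω => by
      rw [Real.norm_of_nonneg (by positivity)]; exact hpt ω)
  refine ⟨(memLp_two_iff_integrable_sq hm).2 hsq, ?_⟩
  rw [← integral_const_mul, ← integral_const_mul, ← integral_add h1 h2]
  exact integral_mono hsq (h1.add h2) hpt

theorem mean_γ_le (hs : IsLearnStep P C σ η m t ρ θ g γ φ)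
    (hg : MemLp (fun ω => (diameter (g ω) : ℝ)) 2 ρ) :
    MemLp (fun ω => mean (γ ω) - mean (g ω)) 2 ρ ∧ ∫ ω, ‖mean (γ ω) - mean (g ω)‖ ^ 2 ∂ρ
      ≤ C ^ 2 * ∫ ω, (diameter (g ω) : ℝ) ^ 2 ∂ρ := by
  have h0 : 0 ≤ ∫ ω, (diameter (g ω) : ℝ) ^ 2 ∂ρ := integral_nonneg fun ω => by positivity
  have hm : AEStronglyMeasurable (fun ω => mean (γ ω) - mean (g ω)) ρ :=
    ((measurable_mean.comp hs.measurable_γ).sub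
      (measurable_mean.comp hs.measurable_g)).aestronglyMeasurable
  have hle := hs.mean_γ
  rw [lintegral_diameter_sq_eq hg, ← ENNReal.ofReal_mul (by positivity)] at hle
  exact ⟨memLp_two_of_lintegral_enorm_sq_le hm hle,
    integral_norm_sq_le_of_lintegral hm (by positivity) hle⟩

theorem mean_φ_le (hs : IsLearnStep P C σ η m t ρ θ g γ φ)
    (hψ : MemLp (fun ω => (diameter (θ ω - η • γ ω) : ℝ)) 2 ρ) :
    MemLp (fun ω => mean (φ ω) - mean (θ ω - η • γ ω)) 2 ρ ∧
    ∫ ω, ‖mean (φ ω) - mean (θ ω - η • γ ω)‖ ^ 2 ∂ρ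
      ≤ C ^ 2 * ∫ ω, (diameter (θ ω - η • γ ω) : ℝ) ^ 2 ∂ρ := by
  have h0 : 0 ≤ ∫ ω, (diameter (θ ω - η • γ ω) : ℝ) ^ 2 ∂ρ :=
    integral_nonneg fun ω => by positivity
  have hm : AEStronglyMeasurable (fun ω => mean (φ ω) - mean (θ ω - η • γ ω)) ρ :=
    ((measurable_mean.comp hs.measurable_φ).sub (measurable_mean.comp
      (hs.measurable_θ.sub (hs.measurable_γ.const_smul η)))).aestronglyMeasurable
  have hle := hs.mean_φ
  rw [lintegral_diameter_sq_eq hψ, ← ENNReal.ofReal_mul (by positivity)] at hle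
  exact ⟨memLp_two_of_lintegral_enorm_sq_le hm hle,
    integral_norm_sq_le_of_lintegral hm (by positivity) hle⟩

theorem diameter_φ_le (hs : IsLearnStep P C σ η m t ρ θ g γ φ)
    (hψ : MemLp (fun ω => (diameter (θ ω - η • γ ω) : ℝ)) 2 ρ) :
    MemLp (fun ω => (diameter (φ ω) : ℝ)) 2 ρ ∧ ∫ ω, (diameter (φ ω) : ℝ) ^ 2 ∂ρ
      ≤ (∫ ω, (diameter (θ ω - η • γ ω) : ℝ) ^ 2 ∂ρ) / 4 := by
  have h0 : 0 ≤ ∫ ω, (diameter (θ ω - η • γ ω) : ℝ) ^ 2 ∂ρ :=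
    integral_nonneg fun ω => by positivity
  refine memLp_diameter_of_lintegral_le hs.measurable_φ (by positivity) (hs.diameter_φ.trans_eq ?_)
  rw [lintegral_diameter_sq_eq hψ, ENNReal.ofReal_div_of_pos (by norm_num)]
  norm_num

/-- The moment estimates of one iteration. -/
theorem moments [IsProbabilityMeasure ρ] (hs : IsLearnStep P C σ η m t ρ θ g γ φ) (hS : P.Smooth L) (hL : 0 < L)
    (hK : P.IsHeterogeneity K) (hK0 : 0 ≤ K) (hP : P.Nonneg) (ht : 1 ≤ t) {δ : ℝ} (hδ : 0 < δ)
    (hδ3 : δ < 3) (hη : η = δ / (12 * L)) {A : ℝ}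
    (hθ : MemLp (fun ω => (diameter (θ ω) : ℝ)) 2 ρ) (hθm : MemLp (fun ω => mean (θ ω)) 2 ρ)
    (hA : A = ∫ ω, (diameter (θ ω) : ℝ) ^ 2 ∂ρ) :
    ∃ G : ℝ, 0 ≤ G ∧
      (∀ κ : ℝ, 0 < κ → G ≤ (1 + κ) * K ^ 2 + (1 + 1 / κ) *
        (2 * L ^ 2 * A + 8 * (h * (σ ^ 2 / m)))) ∧
      MemLp (fun ω => (diameter (φ ω) : ℝ)) 2 ρ ∧
      ∫ ω, (diameter (φ ω) : ℝ) ^ 2 ∂ρ ≤ (2 * A + 2 * η ^ 2 * (G / t ^ 2)) / 4 ∧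
      MemLp (fun ω => mean (φ ω)) 2 ρ ∧
      ∫ ω, P.avgLoss (mean (φ ω)) ∂ρ - ∫ ω, P.avgLoss (mean (θ ω)) ∂ρ ≤
        η * (-(1 / 2 - δ / 8) * ∫ ω, ‖∇ P.avgLoss (mean (θ ω))‖ ^ 2 ∂ρ
          + (1 / 2 + 5 * δ / 48) * (C ^ 2 * G)
          + 30 / δ * (L ^ 2 * A + C ^ 2 * (2 * A / η ^ 2 + 2 * (G / t ^ 2)))
          + 5 * δ / 8 * (h * (σ ^ 2 / m))) := by
  have hh := hK.card_pos
  have hη0 : 0 < η := by rw [hη]; positivity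
  have hLη : L * η = δ / 12 := by rw [hη]; field_simp
  obtain ⟨hg, hGle⟩ := hs.diameter_g_le hS hL.le hK hK0 hθ
  obtain ⟨hγ, hγle⟩ := hs.diameter_γ_le ht hg
  obtain ⟨hψ, hψle⟩ := hs.diameter_half_le hη0.le hθ hγ
  obtain ⟨hφ, hφle⟩ := hs.diameter_φ_le hψ
  obtain ⟨hp, hple⟩ := hs.mean_γ_le hg
  obtain ⟨hr, hrle⟩ := hs.mean_φ_le hψ
  obtain ⟨hξi, hξle⟩ := hs.integral_noise_le hS
  set G := ∫ ω, (diameter (g ω) : ℝ) ^ 2 ∂ρ with hG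
  have hψle' : ∫ ω, (diameter (θ ω - η • γ ω) : ℝ) ^ 2 ∂ρ ≤ 2 * A + 2 * η ^ 2 * (G / t ^ 2) := by
    refine hψle.trans ?_
    rw [hA]
    gcongr
  set n : Ω → Vec d := fun ω => mean (g ω - P.localGrad (θ ω)) with hn
  set q : Ω → Vec d := fun ω => mean (P.localGrad (θ ω)) - ∇ P.avgLoss (mean (θ ω)) with hq
  set p : Ω → Vec d := fun ω => mean (γ ω) - mean (g ω) with hpdef
  set r : Ω → Vec d := fun ω => mean (φ ω) - mean (θ ω - η • γ ω) with hrdef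
  have hgradL := hS.gradient_avgLoss_sub_le hL.le
  have hy : MemLp (fun ω => ∇ P.avgLoss (mean (θ ω))) 2 ρ := memLp_comp_of_lipschitz hgradL hθm
  have hnm : AEStronglyMeasurable n ρ := (measurable_mean.comp
    (hs.measurable_g.sub (hS.measurable_localGrad.comp hs.measurable_θ))).aestronglyMeasurable
  have hnsq : Integrable (fun ω => ‖n ω‖ ^ 2) ρ := hξi.mono' (hnm.norm.pow 2)
    (Filter.Eventually.of_forall fun ω => by
      rw [Real.norm_of_nonneg (by positivity)]; exact norm_mean_sq_le_sum _)
  have hnL : MemLp n 2 ρ := (memLp_two_iff_integrable_sq_norm hnm).2 hnsq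
  have hnle : ∫ ω, ‖n ω‖ ^ 2 ∂ρ ≤ h * (σ ^ 2 / m) :=
    (integral_mono hnsq hξi fun ω => norm_mean_sq_le_sum _).trans hξle
  have hqb : ∀ ω, ‖q ω‖ ≤ L * diameter (θ ω) := fun ω =>
    hS.norm_mean_localGrad_sub_le hL.le hh (θ ω)
  have hqm : AEStronglyMeasurable q ρ := ((measurable_mean.comp
    (hS.measurable_localGrad.comp hs.measurable_θ)).sub
    ((hS.continuous_gradient_avgLoss hL.le).measurable.comp
      (measurable_mean.comp hs.measurable_θ))).aestronglyMeasurable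
  have hqL : MemLp q 2 ρ := (hθ.const_mul L).of_le hqm (Filter.Eventually.of_forall fun ω =>
    (hqb ω).trans (le_abs_self _))
  have hqle : ∫ ω, ‖q ω‖ ^ 2 ∂ρ ≤ L ^ 2 * A := by
    rw [hA, ← integral_const_mul]
    refine integral_mono (hqL.integrable_norm_pow two_ne_zero) (hθ.integrable_sq.const_mul _)
      fun ω => ?_
    have := pow_le_pow_left₀ (norm_nonneg _) (hqb ω) 2
    rwa [mul_pow] at this
  -- The error `r` of the agreement on parameters is charged to the gradient as `η⁻¹ • r`, so that
  -- the whole iteration is one perturbed gradient step. The resulting `A / η ^ 2` is harmless, as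
  -- `A` is of order `η²/t²`.
  have hγφ : ∀ ω, mean (φ ω) = mean (θ ω)
      - η • (∇ P.avgLoss (mean (θ ω)) + p ω + q ω + n ω - η⁻¹ • r ω) := by
    intro ω
    have e1 : ∇ P.avgLoss (mean (θ ω)) + p ω + q ω + n ω = mean (γ ω) := by
      simp only [hpdef, hq, hn, mean_sub]; abel
    rw [e1, smul_sub, smul_smul, mul_inv_cancel₀ hη0.ne', one_smul]
    simp only [hrdef, mean_sub, mean_smul]; abel
  have hsL : MemLp (fun ω => η⁻¹ • r ω) 2 ρ := hr.const_smul η⁻¹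
  have hsle : ∫ ω, ‖η⁻¹ • r ω‖ ^ 2 ∂ρ ≤ C ^ 2 * (2 * A / η ^ 2 + 2 * (G / t ^ 2)) := by
    simp_rw [norm_smul, mul_pow]
    rw [integral_const_mul]
    calc ‖η⁻¹‖ ^ 2 * ∫ ω, ‖r ω‖ ^ 2 ∂ρ
        ≤ ‖η⁻¹‖ ^ 2 * (C ^ 2 * (2 * A + 2 * η ^ 2 * (G / t ^ 2))) := by
          gcongr
          exact hrle.trans (by gcongr)
      _ = _ := by
          rw [Real.norm_of_nonneg (by positivity)]
          field_simp
  have hφm : MemLp (fun ω => mean (φ ω)) 2 ρ := by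
    simp_rw [hγφ]
    exact hθm.sub (((((hy.add hp).add hqL).add hnL).sub hsL).const_smul η)
  have hfi : ∀ {Y : Ω → Vec d}, MemLp Y 2 ρ → Integrable (fun ω => P.avgLoss (Y ω)) ρ :=
    fun hY => integrable_comp_of_lipschitz_gradient hS.differentiable_avgLoss hgradL
      hP.avgLoss hY
  refine ⟨G, integral_nonneg fun ω => by positivity, fun κ hκ => ?_, hφ, ?_, hφm, ?_⟩
  · rw [hA]; exact hGle κ hκ
  · exact hφle.trans (by gcongr)
  · have hin : Integrable (fun ω => inner ℝ (∇ P.avgLoss (mean (θ ω))) (n ω)) ρ :=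
      integrable_inner_of_memLp hy hnL
    have hin0 : ∫ ω, inner ℝ (∇ P.avgLoss (mean (θ ω))) (n ω) ∂ρ = 0 := hs.unbiased
    have iy := hy.integrable_norm_pow two_ne_zero
    have ip := hp.integrable_norm_pow two_ne_zero
    have iq := hqL.integrable_norm_pow two_ne_zero
    have is := hsL.integrable_norm_pow two_ne_zero
    -- The inner product with the noise stays on the left, where its integral vanishes; only `‖n ω‖
    -- ^ 2` with a factor of order `δ` remains on the right.
    have hpt : ∀ ω, P.avgLoss (mean (φ ω)) - P.avgLoss (mean (θ ω))
        + η * inner ℝ (∇ P.avgLoss (mean (θ ω))) (n ω) ≤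
        η * (-(1 / 2 - δ / 8) * ‖∇ P.avgLoss (mean (θ ω))‖ ^ 2 + (1 / 2 + 5 * δ / 48) * ‖p ω‖ ^ 2
        + 30 / δ * (‖q ω‖ ^ 2 + ‖η⁻¹ • r ω‖ ^ 2) + 5 * δ / 8 * ‖n ω‖ ^ 2) := fun ω => by
      rw [hγφ ω]
      exact perturbed_gradient_step hS.differentiable_avgLoss hgradL hη0 hδ hδ3 hLη _ _ _ _ _
    have j1 : Integrable (fun ω => -(1 / 2 - δ / 8) * ‖∇ P.avgLoss (mean (θ ω))‖ ^ 2) ρ :=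
      iy.const_mul _
    have j2 : Integrable (fun ω => (1 / 2 + 5 * δ / 48) * ‖p ω‖ ^ 2) ρ := ip.const_mul _
    have j3 : Integrable (fun ω => 30 / δ * (‖q ω‖ ^ 2 + ‖η⁻¹ • r ω‖ ^ 2)) ρ :=
      (iq.add is).const_mul _
    have j4 : Integrable (fun ω => 5 * δ / 8 * ‖n ω‖ ^ 2) ρ := hnsq.const_mul _
    have jl : Integrable (fun ω => P.avgLoss (mean (φ ω)) - P.avgLoss (mean (θ ω))
        + η * inner ℝ (∇ P.avgLoss (mean (θ ω))) (n ω)) ρ :=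
      ((hfi hφm).sub (hfi hθm)).add (hin.const_mul η)
    have hint := integral_mono jl ((((j1.add j2).add j3).add j4).const_mul η) hpt
    have el : ∫ ω, (P.avgLoss (mean (φ ω)) - P.avgLoss (mean (θ ω))
        + η * inner ℝ (∇ P.avgLoss (mean (θ ω))) (n ω)) ∂ρ
        = ∫ ω, P.avgLoss (mean (φ ω)) ∂ρ - ∫ ω, P.avgLoss (mean (θ ω)) ∂ρ := by
      have e1 := integral_add ((hfi hφm).sub (hfi hθm)) (hin.const_mul η)
      simp only [Pi.sub_apply] at e1
      rw [e1, integral_sub (hfi hφm) (hfi hθm), integral_const_mul, hin0, mul_zero, add_zero]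
    have er : ∫ ω, (η * (-(1 / 2 - δ / 8) * ‖∇ P.avgLoss (mean (θ ω))‖ ^ 2
        + (1 / 2 + 5 * δ / 48) * ‖p ω‖ ^ 2
        + 30 / δ * (‖q ω‖ ^ 2 + ‖η⁻¹ • r ω‖ ^ 2) + 5 * δ / 8 * ‖n ω‖ ^ 2)) ∂ρ
        = η * (-(1 / 2 - δ / 8) * ∫ ω, ‖∇ P.avgLoss (mean (θ ω))‖ ^ 2 ∂ρ
        + (1 / 2 + 5 * δ / 48) * ∫ ω, ‖p ω‖ ^ 2 ∂ρ
        + 30 / δ * (∫ ω, ‖q ω‖ ^ 2 ∂ρ + ∫ ω, ‖η⁻¹ • r ω‖ ^ 2 ∂ρ)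
        + 5 * δ / 8 * ∫ ω, ‖n ω‖ ^ 2 ∂ρ) := by
      have e1 := integral_add ((j1.add j2).add j3) j4
      have e2 := integral_add (j1.add j2) j3
      have e3 := integral_add j1 j2
      have e4 := integral_add iq is
      simp only [Pi.add_apply] at e1 e2
      rw [integral_const_mul, e1, e2, e3, integral_const_mul, integral_const_mul,
        integral_const_mul, e4, integral_const_mul]
    simp only [Pi.add_apply] at hint
    rw [el, er] at hint
    refine hint.trans ?_
    gcongr

end IsLearnStep

end Step

/-! ### The iterations of `Learn` -/

namespace LearningProblem

variable {h d : ℕ} {X : Type u} [MeasurableSpace X] {P : LearningProblem h d X} {L σ : ℝ}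

theorem measurable_stochGrad_left (m : ℕ) (θ : Family h d) : Measurable (P.stochGrad m θ) :=
  Measurable.comp (g := fun p : Family h d × Batch h X m => P.stochGrad m p.1 p.2)
    (f := fun s => (θ, s)) (P.measurable_stochGrad m) measurable_prodMk_left

theorem memLp_batch_noise (hS : P.Smooth L) (hV : P.BoundedVariance σ) (j : Fin h)
    (θ : Family h d) {m : ℕ} (hm : 1 ≤ m) :
    MemLp (fun s => P.stochGrad m θ s j - ∇ (P.localLoss j) (θ j)) 2 (P.batchLaw m) :=
  memLp_two_of_lintegral_enorm_sq_le (Measurable.aestronglyMeasurable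
    ((measurable_pi_iff.1 (measurable_stochGrad_left m θ) j).sub_const _))
    (lintegral_batch_noise_le hS hV j θ hm)

theorem integral_inner_mean_batch_noise (hS : P.Smooth L) (hV : P.BoundedVariance σ)
    (θ : Family h d) {m : ℕ} (hm : 1 ≤ m) (v : Vec d) :
    ∫ s, inner ℝ v (mean (P.stochGrad m θ s - P.localGrad θ)) ∂(P.batchLaw m) = 0 := by
  have hi : ∀ j, Integrable
      (fun s => inner ℝ (P.stochGrad m θ s j - ∇ (P.localLoss j) (θ j)) v) (P.batchLaw m) :=
    fun j => ((memLp_batch_noise hS hV j θ hm).inner_const v).integrable (by norm_num)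
  have e : ∀ s, inner ℝ v (mean (P.stochGrad m θ s - P.localGrad θ))
      = (h : ℝ)⁻¹ * ∑ j, inner ℝ (P.stochGrad m θ s j - ∇ (P.localLoss j) (θ j)) v := by
    intro s
    rw [real_inner_comm, mean, real_inner_smul_left, sum_inner]
    rfl
  simp_rw [e]
  rw [integral_const_mul, integral_finsetSum _ fun j _ => hi j]
  refine mul_eq_zero_of_right _ (Finset.sum_eq_zero fun j _ => ?_)
  exact integral_inner_batch_noise hS hV j θ hm v

end LearningProblem

/-- The guarantees of averaging agreement, averaged over random inputs and attacks. -/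
theorem DistributedAlgorithm.AchievesAveragingAgreement.compProd {h d : ℕ}
    {A : DistributedAlgorithm.{v, w} h d} {C : ℝ} (hA : A.AchievesAveragingAgreement C)
    {α : Type*} [MeasurableSpace α] (ν : Measure α) [SFinite ν] (κ : Kernel α A.Outcome)
    [IsMarkovKernel κ] (N : ℕ) (att : α → A.Attack) {x : α → Family h d} (hx : Measurable x)
    (hκ : ∀ a, κ a = A.run N (att a) (x a)) :
    ∫⁻ z, (diameter (A.output N z.2) : ℝ≥0∞) ^ 2 ∂(ν ⊗ₘ κ)
      ≤ (∫⁻ z, (diameter (x z.1) : ℝ≥0∞) ^ 2 ∂(ν ⊗ₘ κ)) / 4 ^ N ∧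
    ∫⁻ z, ‖mean (A.output N z.2) - mean (x z.1)‖ₑ ^ 2 ∂(ν ⊗ₘ κ)
      ≤ ENNReal.ofReal (C ^ 2) * ∫⁻ z, (diameter (x z.1) : ℝ≥0∞) ^ 2 ∂(ν ⊗ₘ κ) := by
  have hout : Measurable fun z : α × A.Outcome => A.output N z.2 :=
    (A.measurable_output N).comp measurable_snd
  have hx1 : Measurable fun z : α × A.Outcome => x z.1 := hx.comp measurable_fst
  have hd : Measurable fun z : α × A.Outcome => (diameter (x z.1) : ℝ≥0∞) ^ 2 := by fun_prop
  have hd' : Measurable fun a => (diameter (x a) : ℝ≥0∞) ^ 2 := by fun_prop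
  have e : ∫⁻ z, (diameter (x z.1) : ℝ≥0∞) ^ 2 ∂(ν ⊗ₘ κ)
      = ∫⁻ a, (diameter (x a) : ℝ≥0∞) ^ 2 ∂ν := by
    rw [Measure.lintegral_compProd hd]
    simp
  rw [e]
  constructor
  · rw [Measure.lintegral_compProd (by fun_prop), ENNReal.div_eq_inv_mul, mul_comm,
      ← lintegral_mul_const _ hd']
    refine lintegral_mono fun a => ?_
    rw [hκ a]
    exact (hA N (x a) (att a)).1
  · rw [Measure.lintegral_compProd (by fun_prop), ← lintegral_const_mul _ hd']
    refine lintegral_mono fun a => ?_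
    rw [hκ a]
    exact (hA N (x a) (att a)).2

section Learn

variable {h d : ℕ} {X : Type u} [MeasurableSpace X] {b : ℕ → ℕ}
  {A : DistributedAlgorithm.{v, w} h d}

/-- The joint law of everything that happens in iteration `i + 1`. -/
noncomputable def stepLaw (P : LearningProblem h d X) (B : LearnAttack.{u, v, w, z} A X b) (η : ℝ)
    (θ₁ : Vec d) (i : ℕ) :
    Measure ((GradView h d X B.Memory (b (i + 1)) × A.Outcome) × A.Outcome) :=
  (((iterateLaw P B η θ₁ i).prod (P.batchLaw (b (i + 1)))) ⊗ₘ gradKernel P B (i + 1))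
    ⊗ₘ paramKernel B η (i + 1)

variable (P : LearningProblem h d X) (B : LearnAttack.{u, v, w, z} A X b) (η : ℝ) (θ₁ : Vec d)
  (i : ℕ)

instance : IsProbabilityMeasure (stepLaw P B η θ₁ i) := by
  unfold stepLaw; infer_instance

/-- The agreement kernels are Markov, so what happens after the draws does not change the law of
parameters, memory and batch. -/
theorem measurePreserving_stepLaw_start :
    MeasurePreserving (fun z => z.1.1) (stepLaw P B η θ₁ i)
      ((iterateLaw P B η θ₁ i).prod (P.batchLaw (b (i + 1)))) := by
  refine ⟨by fun_prop, ?_⟩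
  have : (fun z : (GradView h d X B.Memory (b (i + 1)) × A.Outcome) × A.Outcome => z.1.1)
      = Prod.fst ∘ Prod.fst := rfl
  rw [this, ← Measure.map_map measurable_fst measurable_fst, stepLaw]
  change Measure.fst (Measure.fst _) = _
  rw [Measure.fst_compProd, Measure.fst_compProd]

theorem measurePreserving_stepLaw_iterate :
    MeasurePreserving (fun z => z.1.1.1) (stepLaw P B η θ₁ i) (iterateLaw P B η θ₁ i) :=
  measurePreserving_fst.comp (measurePreserving_stepLaw_start P B η θ₁ i)

theorem measurePreserving_stepLaw_next :
    MeasurePreserving (fun z => (A.output 1 z.2, B.update (i + 1) z)) (stepLaw P B η θ₁ i)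
      (iterateLaw P B η θ₁ (i + 1)) :=
  ⟨((A.measurable_output 1).comp measurable_snd).prodMk (B.measurable_update _), rfl⟩

/-- The agreement bounds are integrated over the past. The noise bounds follow by integrating first
over the batch with the parameters and the memory fixed, which is possible because their law is a
product. -/
theorem isLearnStep_stepLaw {L C σ : ℝ} (hS : P.Smooth L) (hL : 0 ≤ L)
    (hV : P.BoundedVariance σ)
    (hA : A.AchievesAveragingAgreement C) (hb : 1 ≤ b (i + 1)) :
    IsLearnStep P C σ η (b (i + 1)) (i + 1) (stepLaw P B η θ₁ i)
      (fun z => z.1.1.1.1) (fun z => P.stochGrad (b (i + 1)) z.1.1.1.1 z.1.1.2)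
      (fun z => A.output (agreementLevel (i + 1)) z.1.2) (fun z => A.output 1 z.2) := by
  have hgm : Measurable fun v : GradView h d X B.Memory (b (i + 1)) => P.stochGrad (b (i + 1)) v.1.1 v.2 :=
    Measurable.comp (g := fun p : Family h d × Batch h X (b (i + 1)) => P.stochGrad (b (i + 1)) p.1 p.2)
      (f := fun v : GradView h d X B.Memory (b (i + 1)) => (v.1.1, v.2))
      (P.measurable_stochGrad (b (i + 1))) ((measurable_fst.comp measurable_fst).prodMk measurable_snd)
  have hlm : Measurable fun v : GradView h d X B.Memory (b (i + 1)) => P.localGrad v.1.1 :=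
    hS.measurable_localGrad.comp (measurable_fst.comp measurable_fst)
  have hγm : Measurable fun z : GradView h d X B.Memory (b (i + 1)) × A.Outcome =>
      A.output (agreementLevel (i + 1)) z.2 := (A.measurable_output _).comp measurable_snd
  have hψm : Measurable (halfStep B η (i + 1)) :=
    (measurable_fst.comp (measurable_fst.comp measurable_fst)).sub (hγm.const_smul η)
  have hν := measurePreserving_stepLaw_start P B η θ₁ i
  obtain ⟨hγ1, hγ2⟩ := hA.compProd ((iterateLaw P B η θ₁ i).prod (P.batchLaw (b (i + 1))))
    (gradKernel P B (i + 1)) (agreementLevel (i + 1)) (B.gradAttack (i + 1)) hgm fun _ => rfl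
  obtain ⟨hφ1, hφ2⟩ := hA.compProd
    (((iterateLaw P B η θ₁ i).prod (P.batchLaw (b (i + 1)))) ⊗ₘ gradKernel P B (i + 1))
    (paramKernel B η (i + 1)) 1 (B.paramAttack (i + 1)) hψm fun _ => rfl
  have hfst : MeasurePreserving Prod.fst (stepLaw P B η θ₁ i)
      (((iterateLaw P B η θ₁ i).prod (P.batchLaw (b (i + 1)))) ⊗ₘ gradKernel P B (i + 1)) :=
    ⟨measurable_fst, Measure.fst_compProd _ _⟩
  have hgm1 : Measurable fun z : GradView h d X B.Memory (b (i + 1)) × A.Outcome =>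
      P.stochGrad (b (i + 1)) z.1.1.1 z.1.2 := hgm.comp measurable_fst
  have hdg : Measurable fun z : GradView h d X B.Memory (b (i + 1)) × A.Outcome =>
      (diameter (P.stochGrad (b (i + 1)) z.1.1.1 z.1.2) : ℝ≥0∞) ^ 2 :=
    (measurable_diameter.comp hgm1).coe_nnreal_ennreal.pow_const 2
  have hdγ : Measurable fun z : GradView h d X B.Memory (b (i + 1)) × A.Outcome =>
      (diameter (A.output (agreementLevel (i + 1)) z.2) : ℝ≥0∞) ^ 2 :=
    (measurable_diameter.comp hγm).coe_nnreal_ennreal.pow_const 2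
  have hmγ : Measurable fun z : GradView h d X B.Memory (b (i + 1)) × A.Outcome =>
      ‖mean (A.output (agreementLevel (i + 1)) z.2)
        - mean (P.stochGrad (b (i + 1)) z.1.1.1 z.1.2)‖ₑ ^ 2 :=
    ((measurable_mean.comp hγm).sub (measurable_mean.comp hgm1)).enorm.pow_const 2
  refine ⟨by fun_prop, hgm1.comp measurable_fst, hγm.comp measurable_fst,
    (A.measurable_output 1).comp measurable_snd, fun j => ?_, ?_, ?_, ?_, hφ1, hφ2⟩
  · have hm : Measurable fun v : GradView h d X B.Memory (b (i + 1)) =>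
        ‖(P.stochGrad (b (i + 1)) v.1.1 v.2 - P.localGrad v.1.1) j‖ₑ ^ 2 :=
      ((measurable_pi_iff.1 (hgm.sub hlm) j).enorm.pow_const 2)
    rw [hν.lintegral_comp hm, lintegral_prod _ hm.aemeasurable]
    calc _ ≤ ∫⁻ _, ENNReal.ofReal (σ ^ 2 / b (i + 1)) ∂(iterateLaw P B η θ₁ i) :=
          lintegral_mono fun p => LearningProblem.lintegral_batch_noise_le hS hV j p.1 hb
      _ = _ := by simp
  · have hm : Measurable fun v : GradView h d X B.Memory (b (i + 1)) =>
        (inner ℝ (∇ P.avgLoss (mean v.1.1))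
          (mean (P.stochGrad (b (i + 1)) v.1.1 v.2 - P.localGrad v.1.1)) : ℝ) :=
      ((hS.continuous_gradient_avgLoss hL).measurable.comp (measurable_mean.comp
        (measurable_fst.comp measurable_fst))).inner (measurable_mean.comp (hgm.sub hlm))
    have e := integral_map hν.measurable.aemeasurable
      (by rw [hν.map_eq]; exact hm.aestronglyMeasurable)
    rw [hν.map_eq] at e
    rw [← e]
    -- Fubini needs integrability; in the other case the Bochner integral is 0 by convention, which
    -- is the claimed value.
    by_cases hi : Integrable (fun v : GradView h d X B.Memory (b (i + 1)) =>
        (inner ℝ (∇ P.avgLoss (mean v.1.1))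
          (mean (P.stochGrad (b (i + 1)) v.1.1 v.2 - P.localGrad v.1.1)) : ℝ))
        ((iterateLaw P B η θ₁ i).prod (P.batchLaw (b (i + 1))))
    · rw [integral_prod _ hi]
      simp_rw [LearningProblem.integral_inner_mean_batch_noise hS hV _ hb]
      simp
    · exact integral_undef hi
  · exact (hfst.lintegral_comp hdγ).trans_le (hγ1.trans_eq
      (congrArg (· / _) (hfst.lintegral_comp hdg).symm))
  · exact (hfst.lintegral_comp hmγ).trans_le (hγ2.trans_eq
      (congrArg (_ * ·) (hfst.lintegral_comp hdg).symm))

end Learn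

/-! ### The recursions for the moments -/

section Recursion

/-- Comparison with the telescoping sum of `1/n - 1/(n + 1)`. -/
theorem sum_range_inv_sq_le (n : ℕ) : ∑ i ∈ Finset.range n, 1 / ((i : ℝ) + 1) ^ 2 ≤ 2 := by
  have key : ∀ n : ℕ, ∑ i ∈ Finset.range (n + 1), 1 / ((i : ℝ) + 1) ^ 2 ≤ 2 - 1 / ((n : ℝ) + 1) := by
    intro n
    induction n with
    | zero => norm_num
    | succ n ih =>
      rw [Finset.sum_range_succ]
      have : 1 / (((n + 1 : ℕ) : ℝ) + 1) ^ 2 ≤ 1 / ((n : ℝ) + 1) - 1 / (((n + 1 : ℕ) : ℝ) + 1) := by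
        push_cast
        rw [div_sub_div _ _ (by positivity) (by positivity), div_le_div_iff₀ (by positivity)
          (by positivity)]
        nlinarith [(Nat.cast_nonneg n : (0 : ℝ) ≤ n)]
      linarith
  cases n with
  | zero => norm_num
  | succ n =>
    refine (key n).trans ?_
    have : 0 ≤ 1 / ((n : ℝ) + 1) := by positivity
    linarith

variable {L K C δ η S : ℝ} {A G V Y β : ℕ → ℝ}

/-- The diameters decay quadratically. -/
theorem diameter_recursion (hL : 0 < L) (hδ : 0 < δ) (hδ3 : δ < 3)
    (hη : η = δ / (12 * L)) (hA0 : A 0 = 0) (hA : ∀ i, 0 ≤ A i) (hβ0 : ∀ i, 0 ≤ β i)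
    (hβ : ∀ i, β i ≤ S)
    (hG : ∀ i κ, 0 < κ → G i ≤ (1 + κ) * K ^ 2 + (1 + 1 / κ) * (2 * L ^ 2 * A i + 8 * β i))
    (hA1 : ∀ i : ℕ, A (i + 1) ≤ (2 * A i + 2 * η ^ 2 * (G i / ((i : ℝ) + 1) ^ 2)) / 4) (i : ℕ) :
    A i ≤ 600 * η ^ 2 * (2 * K ^ 2 + 16 * S) / ((i : ℝ) + 1) ^ 2 ∧
      G i ≤ 181 * (2 * K ^ 2 + 16 * S) := by
  have hS : 0 ≤ S := (hβ0 0).trans (hβ 0)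
  set Q := 2 * K ^ 2 + 16 * S with hQ
  have hQ0 : 0 ≤ Q := by positivity
  -- `ηL = δ/12 < 1/4` since `δ < 3`.
  have hηL : η ^ 2 * L ^ 2 ≤ 1 / 16 := by
    have : η ^ 2 * L ^ 2 = δ ^ 2 / 144 := by rw [hη]; field_simp; norm_num
    rw [this]
    nlinarith
  have hGQ : ∀ i, G i ≤ Q + 4 * L ^ 2 * A i := fun i => by
    have := hG i 1 one_pos
    linarith [hβ i]
  -- The induction needs the shift by 4. One step multiplies the bound by `383/600`, where `383 =
  -- 600 · 5/8 + 8`, and the denominator may grow by at most `600/383`; from `(i + 4)²` to `(i +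
  -- 5)²` it grows by at most `25/16`, whereas from `(i + 1)²` it would grow by 4 at `i = 0`.
  have hstrong : ∀ i : ℕ, A i ≤ 600 * η ^ 2 * Q / ((i : ℝ) + 4) ^ 2 := by
    intro i
    induction i with
    | zero => rw [hA0]; positivity
    | succ i ih =>
      have hi : (0 : ℝ) ≤ i := Nat.cast_nonneg i
      have h1 : G i / ((i : ℝ) + 1) ^ 2 ≤ 16 * Q / ((i : ℝ) + 4) ^ 2 + 4 * L ^ 2 * A i := by
        have e1 : Q / ((i : ℝ) + 1) ^ 2 ≤ 16 * Q / ((i : ℝ) + 4) ^ 2 := by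
          rw [div_le_div_iff₀ (by positivity) (by positivity)]
          have : ((i : ℝ) + 4) ^ 2 ≤ 16 * ((i : ℝ) + 1) ^ 2 := by nlinarith
          nlinarith [mul_le_mul_of_nonneg_left this hQ0]
        have e2 : 4 * L ^ 2 * A i / ((i : ℝ) + 1) ^ 2 ≤ 4 * L ^ 2 * A i :=
          div_le_self (mul_nonneg (by positivity) (hA i)) (by nlinarith)
        calc _ ≤ (Q + 4 * L ^ 2 * A i) / ((i : ℝ) + 1) ^ 2 := by
              gcongr; exact hGQ i
          _ = Q / ((i : ℝ) + 1) ^ 2 + 4 * L ^ 2 * A i / ((i : ℝ) + 1) ^ 2 := add_div _ _ _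
          _ ≤ _ := add_le_add e1 e2
      have h2 : A (i + 1) ≤ 5 / 8 * A i + 8 * η ^ 2 * Q / ((i : ℝ) + 4) ^ 2 := by
        have e1 := mul_le_mul_of_nonneg_left h1 (by positivity : 0 ≤ 2 * η ^ 2)
        have e2 := mul_le_mul_of_nonneg_right hηL (hA i)
        have e3 : 2 * η ^ 2 * (16 * Q / ((i : ℝ) + 4) ^ 2 + 4 * L ^ 2 * A i)
            = 4 * (8 * η ^ 2 * Q / ((i : ℝ) + 4) ^ 2) + 8 * (η ^ 2 * L ^ 2 * A i) := by ring
        rw [e3] at e1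
        linarith [hA1 i]
      have h3 : A (i + 1) ≤ 383 * η ^ 2 * Q / ((i : ℝ) + 4) ^ 2 := by
        refine h2.trans ((add_le_add_left (mul_le_mul_of_nonneg_left ih (by norm_num)) _).trans_eq ?_)
        ring
      refine h3.trans ?_
      push_cast
      rw [div_le_div_iff₀ (by positivity) (by positivity)]
      have h4 : 383 * ((i : ℝ) + 1 + 4) ^ 2 ≤ 600 * ((i : ℝ) + 4) ^ 2 := by nlinarith
      have h5 := mul_le_mul_of_nonneg_left h4 (by positivity : 0 ≤ η ^ 2 * Q)
      linarith
  have hi : (0 : ℝ) ≤ i := Nat.cast_nonneg i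
  have h1 : A i ≤ 600 * η ^ 2 * Q / ((i : ℝ) + 1) ^ 2 :=
    (hstrong i).trans (by gcongr; norm_num)
  refine ⟨h1, ?_⟩
  have h2 : A i ≤ 600 * η ^ 2 * Q := h1.trans (div_le_self (by positivity) (by nlinarith))
  have h3 := mul_le_mul_of_nonneg_left h2 (by positivity : 0 ≤ 4 * L ^ 2)
  have h4 := mul_le_mul_of_nonneg_right hηL hQ0
  have h5 : 4 * L ^ 2 * (600 * η ^ 2 * Q) = 2400 * (η ^ 2 * L ^ 2 * Q) := by ring
  linarith [hGQ i]

/-- The excess of the gradient moments over their limit bound, in one iteration. -/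
theorem descent_recursion (hL : 0 < L) (hδ : 0 < δ) (hδ3 : δ < 3)
    (hη : η = δ / (12 * L)) (hA0 : A 0 = 0) (hA : ∀ i, 0 ≤ A i)
    (hβ0 : ∀ i, 0 ≤ β i) (hβ : ∀ i, β i ≤ S) {c : ℝ} (hc : 0 < c) {T₁ : ℕ}
    (hβT : ∀ i, T₁ ≤ i + 1 → β i ≤ S * δ ^ 2 / c)
    (hG : ∀ i κ, 0 < κ → G i ≤ (1 + κ) * K ^ 2 + (1 + 1 / κ) * (2 * L ^ 2 * A i + 8 * β i))
    (hA1 : ∀ i : ℕ, A (i + 1) ≤ (2 * A i + 2 * η ^ 2 * (G i / ((i : ℝ) + 1) ^ 2)) / 4)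
    (hV : ∀ i : ℕ, V (i + 1) - V i ≤ η * (-(1 / 2 - δ / 8) * Y i
      + (1 / 2 + 5 * δ / 48) * (C ^ 2 * G i)
      + 30 / δ * (L ^ 2 * A i + C ^ 2 * (2 * A i / η ^ 2 + 2 * (G i / ((i : ℝ) + 1) ^ 2)))
      + 5 * δ / 8 * β i)) (i : ℕ) :
    (1 / 2 - δ / 8) * Y i + (V (i + 1) - V i) / η ≤
      (1 / 2 + 5 * δ / 48) * (1 + δ / 10) * (C ^ 2 * K ^ 2)
      + (1350 + 48100 * C ^ 2) * (2 * K ^ 2 + 16 * S) / δ * (1 / ((i : ℝ) + 1) ^ 2)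
      + (6 * S + 104 * C ^ 2 * S) * (δ / c)
      + (2 * S + 181 * C ^ 2 * (2 * K ^ 2 + 16 * S)) * (if i + 1 < T₁ then 1 else 0) := by
  have hS : 0 ≤ S := (hβ0 0).trans (hβ 0)
  obtain ⟨hAi, hGi⟩ := diameter_recursion hL hδ hδ3 hη hA0 hA hβ0 hβ hG hA1 i
  set Q := 2 * K ^ 2 + 16 * S with hQ
  have hQ0 : 0 ≤ Q := by positivity
  have hη0 : 0 < η := by rw [hη]; positivity
  have hη2 : η ^ 2 * L ^ 2 = δ ^ 2 / 144 := by rw [hη]; field_simp; norm_num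
  set s : ℝ := 1 / ((i : ℝ) + 1) ^ 2 with hs
  have hs0 : 0 ≤ s := by positivity
  have hAs : A i ≤ 600 * η ^ 2 * Q * s := by rw [hs, mul_one_div]; exact hAi
  have hLA : L ^ 2 * A i ≤ 5 * Q * δ ^ 2 * s := by
    have h1 := mul_le_mul_of_nonneg_left hAs (sq_nonneg L)
    have h2 : L ^ 2 * (600 * η ^ 2 * Q * s) = 600 * Q * s * (η ^ 2 * L ^ 2) := by ring
    rw [h2, hη2] at h1
    have h3 : 0 ≤ Q * δ ^ 2 * s := by positivity
    linarith
  have hAη : A i / η ^ 2 ≤ 600 * Q * s := by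
    rw [div_le_iff₀ (by positivity)]
    linarith
  have hGs : G i / ((i : ℝ) + 1) ^ 2 ≤ 181 * Q * s := by
    rw [hs, mul_one_div]
    gcongr
  have hδ2 : δ ^ 2 ≤ 9 := by nlinarith
  -- Indicator of the early iterations, in which the batches may be small; they are charged a
  -- constant each.
  set ι : ℝ := if i + 1 < T₁ then 1 else 0 with hι
  have hι0 : 0 ≤ ι := by rw [hι]; split_ifs <;> norm_num
  have hβi : 5 * δ / 8 * β i ≤ 6 * S * (δ / c) + 2 * S * ι := by
    by_cases hT : i + 1 < T₁
    · rw [hι, if_pos hT]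
      have h1 : 0 ≤ 6 * S * (δ / c) := by positivity
      have h2 := mul_le_mul (by linarith : 5 * δ / 8 ≤ 2) (hβ i) (hβ0 i) (by norm_num)
      linarith
    · rw [hι, if_neg hT]
      have h1 := mul_le_mul_of_nonneg_left (hβT i (not_lt.1 hT))
        (by positivity : 0 ≤ 5 * δ / 8)
      have h2 : 5 * δ / 8 * (S * δ ^ 2 / c) = 5 / 8 * δ ^ 2 * (S * (δ / c)) := by ring
      have h3 : 5 / 8 * δ ^ 2 * (S * (δ / c)) ≤ 6 * (S * (δ / c)) :=
        mul_le_mul_of_nonneg_right (by linarith) (by positivity)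
      linarith
  have hGexc : G i ≤ (1 + δ / 10) * K ^ 2 + 1170 * Q / δ * s + 104 * S * (δ / c) + 181 * Q * ι := by
    have h1 : 0 ≤ 1170 * Q / δ * s := by positivity
    have h2 : 0 ≤ 104 * S * (δ / c) := by positivity
    by_cases hT : i + 1 < T₁
    · rw [hι, if_pos hT]
      have h3 : 0 ≤ (1 + δ / 10) * K ^ 2 := by positivity
      linarith
    · rw [hι, if_neg hT]
      -- A weight of order `δ` keeps the coefficient of `K²` at `1 + O(δ)`; the factor `1/δ` on the
      -- noise is absorbed by `β i = O(δ²/c)`. In the early iterations the uniform bound `181 * Q`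
      -- is used instead.
      have h3 := hG i (δ / 10) (by positivity)
      have h4 : 1 + 1 / (δ / 10) ≤ 13 / δ := by
        rw [one_div_div, ← sub_nonneg]
        have : 13 / δ - (1 + 10 / δ) = (3 - δ) / δ := by field_simp; ring
        rw [this]
        exact div_nonneg (by linarith) hδ.le
      have h5 : 2 * L ^ 2 * A i + 8 * β i ≤ 10 * Q * δ ^ 2 * s + 8 * (S * δ ^ 2 / c) := by
        linarith [hβT i (not_lt.1 hT)]
      have h6 := mul_le_mul h4 h5
        (add_nonneg (mul_nonneg (by positivity) (hA i)) (mul_nonneg (by norm_num) (hβ0 i)))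
        (by positivity)
      have h7 : 13 / δ * (10 * Q * δ ^ 2 * s + 8 * (S * δ ^ 2 / c))
          = 130 * (Q / δ * s) * δ ^ 2 + 104 * S * (δ / c) := by field_simp; ring
      have h8 : 130 * (Q / δ * s) * δ ^ 2 ≤ 130 * (Q / δ * s) * 9 :=
        mul_le_mul_of_nonneg_left hδ2 (by positivity)
      have h9 : 1170 * Q / δ * s = 130 * (Q / δ * s) * 9 := by ring
      linarith
  have hGc : (1 / 2 + 5 * δ / 48) * (C ^ 2 * G i) ≤
      (1 / 2 + 5 * δ / 48) * (1 + δ / 10) * (C ^ 2 * K ^ 2)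
        + C ^ 2 * (1170 * Q / δ * s + 104 * S * (δ / c) + 181 * Q * ι) := by
    have h1 := mul_le_mul_of_nonneg_left hGexc
      (by positivity : 0 ≤ (1 / 2 + 5 * δ / 48) * C ^ 2)
    have h2 : 0 ≤ C ^ 2 * (1170 * Q / δ * s + 104 * S * (δ / c) + 181 * Q * ι) := by positivity
    have h3 := mul_le_mul_of_nonneg_right (by linarith : 1 / 2 + 5 * δ / 48 ≤ 1) h2
    linarith
  have hmid : 30 / δ * (L ^ 2 * A i + C ^ 2 * (2 * A i / η ^ 2 + 2 * (G i / ((i : ℝ) + 1) ^ 2)))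
      ≤ (1350 + 46860 * C ^ 2) * Q / δ * s := by
    have h1 : 5 * Q * δ ^ 2 * s ≤ 45 * Q * s := by
      have := mul_le_mul_of_nonneg_left hδ2 (by positivity : 0 ≤ 5 * Q * s)
      linarith
    have h2 : L ^ 2 * A i + C ^ 2 * (2 * A i / η ^ 2 + 2 * (G i / ((i : ℝ) + 1) ^ 2))
        ≤ (45 + 1562 * C ^ 2) * Q * s := by
      have h3 : 2 * A i / η ^ 2 + 2 * (G i / ((i : ℝ) + 1) ^ 2) ≤ 1562 * Q * s := by
        rw [mul_div_assoc]; linarith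
      have h4 := mul_le_mul_of_nonneg_left h3 (sq_nonneg C)
      linarith
    refine (mul_le_mul_of_nonneg_left h2 (by positivity)).trans_eq ?_
    ring
  have hVi : (V (i + 1) - V i) / η ≤ -(1 / 2 - δ / 8) * Y i
      + (1 / 2 + 5 * δ / 48) * (C ^ 2 * G i)
      + 30 / δ * (L ^ 2 * A i + C ^ 2 * (2 * A i / η ^ 2 + 2 * (G i / ((i : ℝ) + 1) ^ 2)))
      + 5 * δ / 8 * β i := by
    rw [div_le_iff₀' hη0]; exact hV i
  have e1 : (1350 + 48100 * C ^ 2) * Q / δ * s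
      = (1350 + 46860 * C ^ 2) * Q / δ * s + C ^ 2 * (1170 * Q / δ * s)
        + 70 * C ^ 2 * (Q / δ * s) := by ring
  have e2 : 0 ≤ 70 * C ^ 2 * (Q / δ * s) := by positivity
  linarith

/-- The left factor collects the relative losses of one iteration; the `δ / 4` is the reserve for
all error terms that vanish on average. The right side is the coefficient of the gradient moment
times the target. -/
theorem slack_le (hδ : 0 < δ) (hδ3 : δ < 3) :
    (1 / 2 + 5 * δ / 48) * (1 + δ / 10) + δ / 4 ≤ (1 / 2 - δ / 8) * (1 + δ) ^ 2 := by
  nlinarith [mul_pos hδ (by linarith : 0 < 3 - δ),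
    mul_pos (mul_pos hδ hδ) (by linarith : 0 < 3 - δ)]

/-- The moments at a uniformly chosen index. -/
theorem average_moments_le (hL : 0 < L) (hK : 0 < K) (hC : 0 < C) (hδ : 0 < δ) (hδ3 : δ < 3)
    (hη : η = δ / (12 * L)) (hA0 : A 0 = 0) (hA : ∀ i, 0 ≤ A i)
    (hVn : ∀ i, 0 ≤ V i)
    (hβ0 : ∀ i, 0 ≤ β i) (hβ : ∀ i, β i ≤ S) {c : ℝ} (hc : 0 < c) {T₁ T : ℕ}
    (hβT : ∀ i, T₁ ≤ i + 1 → β i ≤ S * δ ^ 2 / c)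
    (hG : ∀ i κ, 0 < κ → G i ≤ (1 + κ) * K ^ 2 + (1 + 1 / κ) * (2 * L ^ 2 * A i + 8 * β i))
    (hA1 : ∀ i : ℕ, A (i + 1) ≤ (2 * A i + 2 * η ^ 2 * (G i / ((i : ℝ) + 1) ^ 2)) / 4)
    (hV : ∀ i : ℕ, V (i + 1) - V i ≤ η * (-(1 / 2 - δ / 8) * Y i
      + (1 / 2 + 5 * δ / 48) * (C ^ 2 * G i)
      + 30 / δ * (L ^ 2 * A i + C ^ 2 * (2 * A i / η ^ 2 + 2 * (G i / ((i : ℝ) + 1) ^ 2)))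
      + 5 * δ / 8 * β i))
    {D : ℝ} (hV0 : V 0 ≤ D)
    (hc1 : 600 * (2 * K ^ 2 + 16 * S) / L ^ 2 ≤ c)
    (hc2 : 4 * (3 * (12 * L * D + 2 * ((1350 + 48100 * C ^ 2) * (2 * K ^ 2 + 16 * S)))
      + (6 * S + 104 * C ^ 2 * S) + (2 * S + 181 * C ^ 2 * (2 * K ^ 2 + 16 * S)))
        ≤ c * (C ^ 2 * K ^ 2))
    (hT : c / δ * max (1 / δ ^ 2) (T₁ : ℝ) ≤ T) :
    0 < T ∧ ∑ i ∈ Finset.range T, A i ≤ T * δ ^ 2 ∧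
      ∑ i ∈ Finset.range T, Y i ≤ T * ((1 + δ) ^ 2 * C ^ 2 * K ^ 2) := by
  have hS : 0 ≤ S := (hβ0 0).trans (hβ 0)
  have hη0 : 0 < η := by rw [hη]; positivity
  have hdesc := descent_recursion hL hδ hδ3 hη hA0 hA hβ0 hβ hc hβT hG hA1 hV
  have hdiam := diameter_recursion hL hδ hδ3 hη hA0 hA hβ0 hβ hG hA1
  set Q := 2 * K ^ 2 + 16 * S with hQ
  have hQ0 : 0 < Q := by positivity
  set M₁ := (1350 + 48100 * C ^ 2) * Q with hM₁
  set M₂ := 6 * S + 104 * C ^ 2 * S with hM₂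
  set M₃ := 2 * S + 181 * C ^ 2 * Q with hM₃
  have hM₁0 : 0 ≤ M₁ := by positivity
  have hM₃0 : 0 ≤ M₃ := by positivity
  have hD : 0 ≤ D := (hVn 0).trans hV0
  have hT1 : c / δ ^ 3 ≤ T := by
    refine le_trans (le_of_eq ?_) ((mul_le_mul_of_nonneg_left (le_max_left _ _)
      (by positivity)).trans hT)
    field_simp
  have hT2 : c / δ * T₁ ≤ T :=
    (mul_le_mul_of_nonneg_left (le_max_right _ _) (by positivity)).trans hT
  have hT0 : (0 : ℝ) < T := lt_of_lt_of_le (by positivity) hT1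
  have hcT : c ≤ T * δ ^ 3 := (div_le_iff₀ (by positivity)).1 hT1
  have hδ2 : δ ^ 2 ≤ 9 := by nlinarith
  have hinv := sum_range_inv_sq_le T
  refine ⟨by exact_mod_cast hT0, ?_, ?_⟩
  · have h1 : ∑ i ∈ Finset.range T, A i
        ≤ ∑ i ∈ Finset.range T, 600 * η ^ 2 * Q * (1 / ((i : ℝ) + 1) ^ 2) :=
      Finset.sum_le_sum fun i _ => by rw [mul_one_div]; exact (hdiam i).1
    rw [← Finset.mul_sum] at h1
    have h2 := mul_le_mul_of_nonneg_left hinv (by positivity : 0 ≤ 600 * η ^ 2 * Q)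
    have h3 : 600 * η ^ 2 * Q * 2 = 600 * Q / L ^ 2 * (δ ^ 2 / 72) := by
      rw [hη]; field_simp; norm_num
    have h4 := mul_le_mul_of_nonneg_right (hc1.trans hcT) (by positivity : 0 ≤ δ ^ 2 / 72)
    have h5 : T * δ ^ 3 * (δ ^ 2 / 72) = T * δ ^ 2 * (δ * δ ^ 2 / 72) := by ring
    have h6 : T * δ ^ 2 * (δ * δ ^ 2 / 72) ≤ T * δ ^ 2 * 1 :=
      mul_le_mul_of_nonneg_left (by nlinarith) (by positivity)
    linarith
  -- There are at most `T₁` early iterations, whatever `T` is.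
  · have hιsum : ∑ i ∈ Finset.range T, (if i + 1 < T₁ then (1 : ℝ) else 0) ≤ T₁ := by
      rw [Finset.sum_boole]
      have : (Finset.filter (fun i => i + 1 < T₁) (Finset.range T)).card ≤ T₁ := by
        calc _ ≤ (Finset.range T₁).card := Finset.card_le_card fun i hi => by
              simp only [Finset.mem_filter, Finset.mem_range] at hi ⊢; omega
          _ = T₁ := Finset.card_range _
      exact_mod_cast this
    set R := (1 / 2 + 5 * δ / 48) * (1 + δ / 10) * (C ^ 2 * K ^ 2) with hR
    have hsum := Finset.sum_le_sum fun i (_ : i ∈ Finset.range T) => hdesc i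
    rw [Finset.sum_add_distrib, Finset.sum_add_distrib, Finset.sum_add_distrib,
      Finset.sum_add_distrib, ← Finset.mul_sum, ← Finset.sum_div, Finset.sum_range_sub,
      Finset.sum_const, Finset.sum_const, Finset.card_range, ← Finset.mul_sum, ← Finset.mul_sum,
      nsmul_eq_mul, nsmul_eq_mul] at hsum
    clear_value R M₁ M₂ M₃ Q
    clear hdesc hdiam hV hA1 hG hβT hβ hβ0 hc1 hT
    -- The telescoped loss: the last value is non-negative and the first is at most `D`.
    have h1 : -(D / η) ≤ (V T - V 0) / η := by
      rw [← neg_div]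
      gcongr
      linarith [hVn T]
    have h2 := mul_le_mul_of_nonneg_left hinv (by positivity : 0 ≤ M₁ / δ)
    have h3 := mul_le_mul_of_nonneg_left hιsum hM₃0
    have h4 : D / η = 12 * L * D / δ := by rw [hη]; field_simp
    have h5 : (T₁ : ℝ) ≤ T * (δ / c) := by
      have : c / δ * T₁ * (δ / c) = T₁ := by field_simp
      rw [← this]
      exact mul_le_mul_of_nonneg_right hT2 (by positivity)
    have h6 := mul_le_mul_of_nonneg_left h5 hM₃0
    -- From `c ≤ T δ³` and `δ < 3`. Thus every error total, of order `1/δ`, `T₁` or `T δ/c`, is a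
    -- constant times `T δ/c`, and `hc2` makes their sum at most `T · δ/4 · C²K²`.
    have h7 : 1 / δ ≤ T * (δ / c) * 3 := by
      have e1 : 1 / δ ≤ T * (δ / c) * δ := by
        rw [div_le_iff₀ hδ, show T * (δ / c) * δ * δ = T * δ ^ 3 / c by ring, le_div_iff₀ hc]
        linarith
      exact e1.trans (mul_le_mul_of_nonneg_left hδ3.le (by positivity))
    have h8 := mul_le_mul_of_nonneg_left h7 (by positivity : 0 ≤ 12 * L * D + 2 * M₁)
    have h9 := mul_le_mul_of_nonneg_left hc2 (by positivity : 0 ≤ T * (δ / c) / 4)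
    have h10 : T * (δ / c) / 4 * (c * (C ^ 2 * K ^ 2)) = T * (δ / 4 * (C ^ 2 * K ^ 2)) := by
      field_simp
    have h11 : 12 * L * D / δ + M₁ / δ * 2 = (12 * L * D + 2 * M₁) * (1 / δ) := by ring
    have h12 : (1 / 2 - δ / 8) * ∑ i ∈ Finset.range T, Y i
        ≤ T * (R + δ / 4 * (C ^ 2 * K ^ 2)) := by
      rw [h10] at h9
      linarith
    have h13 : R + δ / 4 * (C ^ 2 * K ^ 2)
        ≤ (1 / 2 - δ / 8) * ((1 + δ) ^ 2 * C ^ 2 * K ^ 2) := by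
      have e2 := mul_le_mul_of_nonneg_right (slack_le hδ hδ3) (by positivity : 0 ≤ C ^ 2 * K ^ 2)
      rw [hR]
      linarith
    have h14 := h12.trans (mul_le_mul_of_nonneg_left h13 hT0.le)
    have h15 : 0 < 1 / 2 - δ / 8 := by linarith
    refine le_of_mul_le_mul_left (h14.trans_eq ?_) h15
    ring

end Recursion
/-! ### The moments of the iterates -/

section Iterates

theorem integral_comp_of_measurePreserving {Ω Ω' E : Type*} [MeasurableSpace Ω]
    [MeasurableSpace Ω'] [NormedAddCommGroup E] [NormedSpace ℝ E] {ρ : Measure Ω} {μ : Measure Ω'}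
    {T : Ω → Ω'} (hT : MeasurePreserving T ρ μ) {f : Ω' → E} (hf : AEStronglyMeasurable f μ) :
    ∫ ω, f (T ω) ∂ρ = ∫ ω, f ω ∂μ := by
  have := integral_map (φ := T) (f := f) hT.measurable.aemeasurable (by rw [hT.map_eq]; exact hf)
  rw [hT.map_eq] at this
  exact this.symm

variable {h d : ℕ} {X : Type u} [MeasurableSpace X] {b : ℕ → ℕ}
  {A : DistributedAlgorithm.{v, w} h d} {P : LearningProblem h d X}
  {B : LearnAttack.{u, v, w, z} A X b} {L K C σ η δ : ℝ} {θ₁ : Vec d}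

theorem aestronglyMeasurable_diameter_fst {M : Type*} [MeasurableSpace M]
    (μ : Measure (Family h d × M)) :
    AEStronglyMeasurable (fun p => (diameter p.1 : ℝ)) μ :=
  (measurable_diameter.comp measurable_fst).coe_nnreal_real.aestronglyMeasurable

theorem measurable_mean_fst {M : Type*} [MeasurableSpace M] :
    Measurable (fun p : Family h d × M => mean p.1) :=
  measurable_mean.comp measurable_fst

/-- `IsLearnStep.moments`, transported from the joint law of an iteration to the laws of the
parameters before and after it. `G` is the second moment of the diameter of the stochastic
gradients. -/
theorem iterate_moments (hS : P.Smooth L) (hL : 0 < L) (hV : P.BoundedVariance σ)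
    (hK : P.IsHeterogeneity K) (hK0 : 0 ≤ K) (hP : P.Nonneg) (hδ : 0 < δ) (hδ3 : δ < 3)
    (hη : η = δ / (12 * L)) (hA : A.AchievesAveragingAgreement C) (i : ℕ) (hb : 1 ≤ b (i + 1))
    (hd : MemLp (fun p => (diameter p.1 : ℝ)) 2 (iterateLaw P B η θ₁ i))
    (hm : MemLp (fun p => mean p.1) 2 (iterateLaw P B η θ₁ i)) :
    MemLp (fun p => (diameter p.1 : ℝ)) 2 (iterateLaw P B η θ₁ (i + 1)) ∧
    MemLp (fun p => mean p.1) 2 (iterateLaw P B η θ₁ (i + 1)) ∧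
    ∃ G : ℝ,
      (∀ κ : ℝ, 0 < κ → G ≤ (1 + κ) * K ^ 2 + (1 + 1 / κ) *
        (2 * L ^ 2 * ∫ p, (diameter p.1 : ℝ) ^ 2 ∂(iterateLaw P B η θ₁ i)
          + 8 * (h * (σ ^ 2 / b (i + 1))))) ∧
      ∫ p, (diameter p.1 : ℝ) ^ 2 ∂(iterateLaw P B η θ₁ (i + 1))
        ≤ (2 * ∫ p, (diameter p.1 : ℝ) ^ 2 ∂(iterateLaw P B η θ₁ i)
          + 2 * η ^ 2 * (G / ((i : ℝ) + 1) ^ 2)) / 4 ∧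
      ∫ p, P.avgLoss (mean p.1) ∂(iterateLaw P B η θ₁ (i + 1))
          - ∫ p, P.avgLoss (mean p.1) ∂(iterateLaw P B η θ₁ i) ≤
        η * (-(1 / 2 - δ / 8) * ∫ p, ‖∇ P.avgLoss (mean p.1)‖ ^ 2 ∂(iterateLaw P B η θ₁ i)
          + (1 / 2 + 5 * δ / 48) * (C ^ 2 * G)
          + 30 / δ * (L ^ 2 * ∫ p, (diameter p.1 : ℝ) ^ 2 ∂(iterateLaw P B η θ₁ i)
            + C ^ 2 * (2 * (∫ p, (diameter p.1 : ℝ) ^ 2 ∂(iterateLaw P B η θ₁ i)) / η ^ 2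
              + 2 * (G / ((i : ℝ) + 1) ^ 2)))
          + 5 * δ / 8 * (h * (σ ^ 2 / b (i + 1)))) := by
  have hs := isLearnStep_stepLaw P B η θ₁ i hS hL.le hV hA hb
  have hstart := measurePreserving_stepLaw_iterate P B η θ₁ i
  have hnext := measurePreserving_stepLaw_next P B η θ₁ i
  have hloss : ∀ j, AEStronglyMeasurable (fun p => P.avgLoss (mean p.1))
      (iterateLaw P B η θ₁ j) := fun j =>
    (hS.differentiable_avgLoss.continuous.measurable.comp measurable_mean_fst).aestronglyMeasurable
  have hgrad : AEStronglyMeasurable (fun p => ‖∇ P.avgLoss (mean p.1)‖ ^ 2)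
      (iterateLaw P B η θ₁ i) :=
    ((hS.continuous_gradient_avgLoss hL.le).measurable.comp
      measurable_mean_fst).aestronglyMeasurable.norm.pow 2
  have hdsq : ∀ j, AEStronglyMeasurable (fun p => (diameter p.1 : ℝ) ^ 2)
      (iterateLaw P B η θ₁ j) := fun j => (aestronglyMeasurable_diameter_fst _).pow 2
  obtain ⟨G, -, h1, h2, h3, h4, h5⟩ := hs.moments hS hL hK hK0 hP (Nat.succ_le_succ i.zero_le)
    hδ hδ3 hη (hd.comp_measurePreserving hstart) (hm.comp_measurePreserving hstart) rfl
  have a1 := integral_comp_of_measurePreserving hstart (hdsq i)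
  have a2 := integral_comp_of_measurePreserving hnext (hdsq (i + 1))
  have a3 := integral_comp_of_measurePreserving hstart (hloss i)
  have a4 := integral_comp_of_measurePreserving hnext (hloss (i + 1))
  have a5 := integral_comp_of_measurePreserving hstart hgrad
  simp only at a1 a2 a3 a4 a5
  rw [a1] at h1
  rw [a1, a2] at h3
  rw [a1, a3, a4, a5] at h5
  push_cast at h3 h5
  refine ⟨?_, ?_, G, h1, h3, h5⟩
  · have := memLp_map_measure_iff (p := 2) (f := fun z => (A.output 1 z.2, B.update (i + 1) z))
      (μ := stepLaw P B η θ₁ i) (g := fun p => (diameter p.1 : ℝ))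
      (aestronglyMeasurable_diameter_fst _) hnext.measurable.aemeasurable
    rw [hnext.map_eq] at this
    exact this.2 h2
  · have := memLp_map_measure_iff (p := 2) (f := fun z => (A.output 1 z.2, B.update (i + 1) z))
      (μ := stepLaw P B η θ₁ i) (g := fun p => mean p.1)
      measurable_mean_fst.aestronglyMeasurable hnext.measurable.aemeasurable
    rw [hnext.map_eq] at this
    exact this.2 h4

theorem integral_iterateLaw_zero {E : Type*} [NormedAddCommGroup E] [NormedSpace ℝ E]
    [CompleteSpace E] {f : Family h d → E} (hf : StronglyMeasurable f) :
    ∫ p, f p.1 ∂(iterateLaw P B η θ₁ 0) = f fun _ => θ₁ := by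
  have hmp : MeasurePreserving Prod.fst (iterateLaw P B η θ₁ 0)
      (Measure.dirac fun _ : Fin h => θ₁) := measurePreserving_fst
  rw [integral_comp_of_measurePreserving hmp hf.aestronglyMeasurable, integral_dirac' _ _ hf]

theorem memLp_iterateLaw (hS : P.Smooth L) (hL : 0 < L) (hV : P.BoundedVariance σ)
    (hK : P.IsHeterogeneity K) (hK0 : 0 ≤ K) (hP : P.Nonneg) (hδ : 0 < δ) (hδ3 : δ < 3)
    (hη : η = δ / (12 * L)) (hA : A.AchievesAveragingAgreement C) (hb : ∀ t, 1 ≤ t → 1 ≤ b t)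
    (i : ℕ) :
    MemLp (fun p => (diameter p.1 : ℝ)) 2 (iterateLaw P B η θ₁ i) ∧
    MemLp (fun p => mean p.1) 2 (iterateLaw P B η θ₁ i) := by
  induction i with
  | zero =>
    have hmp : MeasurePreserving Prod.fst (iterateLaw P B η θ₁ 0)
        (Measure.dirac fun _ : Fin h => θ₁) := measurePreserving_fst
    constructor
    · refine MemLp.comp_measurePreserving (g := fun x : Family h d => (diameter x : ℝ)) ?_ hmp
      refine memLp_two_of_lintegral_enorm_sq_ne_top
        measurable_diameter.coe_nnreal_real.aestronglyMeasurable ?_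
      rw [lintegral_dirac' _ (by fun_prop)]
      simp
    · refine MemLp.comp_measurePreserving (g := fun x : Family h d => mean x) ?_ hmp
      refine memLp_two_of_lintegral_enorm_sq_ne_top measurable_mean.aestronglyMeasurable ?_
      rw [lintegral_dirac' _ (measurable_mean.enorm.pow_const 2)]
      simp
  | succ i ih =>
    obtain ⟨h1, h2, -⟩ := iterate_moments hS hL hV hK hK0 hP hδ hδ3 hη hA i
      (hb (i + 1) (Nat.succ_le_succ i.zero_le)) ih.1 ih.2
    exact ⟨h1, h2⟩

/-- The output law is the uniform mixture of the laws of the iterates, so its moments are averages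
over the iterations. -/
theorem lintegral_learn_le {f : Family h d → ℝ≥0∞} (hf : Measurable f) {T : ℕ} (hT : 0 < T)
    {a : ℕ → ℝ} {r : ℝ} (ha : ∀ i, 0 ≤ a i)
    (h1 : ∀ i, ∫⁻ p, f p.1 ∂(iterateLaw P B (δ / (12 * L)) θ₁ i) = ENNReal.ofReal (a i))
    (h2 : ∑ i ∈ Finset.range T, a i ≤ T * r) :
    ∫⁻ θ, f θ ∂(learn P B L δ θ₁ T) ≤ ENNReal.ofReal r := by
  rw [learn, lintegral_smul_measure, lintegral_finsetSum_measure]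
  simp_rw [lintegral_map hf measurable_fst, h1]
  rw [← ENNReal.ofReal_sum_of_nonneg fun i _ => ha i, smul_eq_mul]
  have hT0 : (T : ℝ≥0∞) ≠ 0 := by exact_mod_cast hT.ne'
  rw [mul_comm, ← div_eq_mul_inv]
  refine ENNReal.div_le_of_le_mul' ((ENNReal.ofReal_le_ofReal h2).trans_eq ?_)
  rw [ENNReal.ofReal_mul (by positivity), ENNReal.ofReal_natCast]

end Iterates

end ByzLearn

/-! ### Choice of the constant and conclusion -/

theorem mainTheorem1 (h : ℕ) (L K C σ Lmax : ℝ) (hK : 0 < K) (hC : 0 < C) :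
    ∃ c : ℝ, 0 < c ∧
      ∀ (δ : ℝ), 0 < δ → δ < 3 →
      ∀ (b : ℕ → ℕ) (T₁ T : ℕ),
        (∀ t, 1 ≤ t → 1 ≤ b t) →
        (∀ t, T₁ ≤ t → c / δ ^ 2 ≤ (b t : ℝ)) →
        c / δ * max (1 / δ ^ 2) (T₁ : ℝ) ≤ (T : ℝ) →
      ∀ (d : ℕ) (X : Type*) [MeasurableSpace X] (P : ByzLearn.LearningProblem h d X) (θ₁ : ByzLearn.Vec d),
        P.Nonneg → P.Smooth L → P.BoundedVariance σ → P.InitialLossLE θ₁ Lmax →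
        P.IsHeterogeneity K →
      ∀ (Avg : ByzLearn.DistributedAlgorithm h d), Avg.AchievesAveragingAgreement C →
      ∀ (Byz : ByzLearn.LearnAttack Avg X b),
        P.CollaborativeGuarantee C K δ (ByzLearn.learn P Byz L δ θ₁ T) := by
  have hCK : 0 < C ^ 2 * K ^ 2 := by positivity
  set S : ℝ := h * σ ^ 2 with hSdef
  have hS0 : 0 ≤ S := by positivity
  set c₁ := 600 * (2 * K ^ 2 + 16 * S) / L ^ 2 with hc₁
  set c₂ := 4 * (3 * (12 * L * Lmax + 2 * ((1350 + 48100 * C ^ 2) * (2 * K ^ 2 + 16 * S)))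
      + (6 * S + 104 * C ^ 2 * S) + (2 * S + 181 * C ^ 2 * (2 * K ^ 2 + 16 * S))) with hc₂
  -- The constant is chosen before any learning problem is given, when nothing is known about the
  -- signs of `L` and `Lmax`; the 1 guarantees positivity.
  refine ⟨max 1 (max c₁ (c₂ / (C ^ 2 * K ^ 2))), by positivity, ?_⟩
  set c := max 1 (max c₁ (c₂ / (C ^ 2 * K ^ 2))) with hcdef
  have hc : 0 < c := by positivity
  have hcc₁ : c₁ ≤ c := (le_max_left _ _).trans (le_max_right _ _)
  have hcc₂ : c₂ ≤ c * (C ^ 2 * K ^ 2) :=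
    (div_le_iff₀ hCK).1 ((le_max_right _ _).trans (le_max_right _ _))
  clear_value c
  intro δ hδ hδ3 b T₁ T hb hbT hT d X _ P θ₁ hP hS hV hI hhet Avg hAvg Byz
  have hL := hhet.smooth_pos hK hP hS
  have hh := hhet.card_pos
  obtain ⟨η, hη⟩ : ∃ η, η = δ / (12 * L) := ⟨_, rfl⟩
  set μ := ByzLearn.iterateLaw P Byz η θ₁ with hμ
  have hmem : ∀ i, _ := ByzLearn.memLp_iterateLaw (B := Byz) (θ₁ := θ₁) hS hL hV hhet hK.le hP hδ hδ3
    hη hAvg hb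
  have hmom : ∀ i, _ := fun i => (ByzLearn.iterate_moments (B := Byz) (θ₁ := θ₁) hS hL hV hhet hK.le
    hP hδ hδ3 hη hAvg i (hb (i + 1) (Nat.succ_le_succ i.zero_le)) (hmem i).1 (hmem i).2).2.2
  choose G hG1 hG2 hG3 using hmom
  have hgradL : ∀ i, MemLp (fun p => ∇ P.avgLoss (ByzLearn.mean p.1)) 2 (μ i) := fun i =>
    ByzLearn.memLp_comp_of_lipschitz (hS.gradient_avgLoss_sub_le hL.le) (hmem i).2
  obtain ⟨hT0, hAsum, hYsum⟩ := ByzLearn.average_moments_le (S := S) (D := Lmax) (T₁ := T₁) (T := T)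
    (A := fun i => ∫ p, (ByzLearn.diameter p.1 : ℝ) ^ 2 ∂(μ i)) (G := G)
    (V := fun i => ∫ p, P.avgLoss (ByzLearn.mean p.1) ∂(μ i))
    (Y := fun i => ∫ p, ‖∇ P.avgLoss (ByzLearn.mean p.1)‖ ^ 2 ∂(μ i))
    -- Index `i` stands for iteration `i + 1`. The factor `h` comes from summing the noise over the
    -- nodes.
    (β := fun i => h * (σ ^ 2 / b (i + 1))) hL hK hC hδ hδ3 hη
    (by
      rw [hμ, ByzLearn.integral_iterateLaw_zero
        (f := fun x : ByzLearn.Family h d => (ByzLearn.diameter x : ℝ) ^ 2)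
        (ByzLearn.measurable_diameter.coe_nnreal_real.pow_const 2).stronglyMeasurable,
        ByzLearn.diameter_const]
      simp)
    (fun i => integral_nonneg fun _ => by positivity)
    (fun i => integral_nonneg fun _ => hP.avgLoss _)
    (fun i => by positivity)
    (fun i => by
      have h1 : (1 : ℝ) ≤ b (i + 1) := by exact_mod_cast hb (i + 1) (Nat.succ_le_succ i.zero_le)
      rw [hSdef]
      gcongr
      exact div_le_self (sq_nonneg σ) h1)
    hc
    (fun i hi => by
      have h1 := hbT (i + 1) hi
      have h2 : 0 < c / δ ^ 2 := by positivity
      calc h * (σ ^ 2 / b (i + 1)) ≤ h * (σ ^ 2 / (c / δ ^ 2)) := by gcongr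
        _ = S * δ ^ 2 / c := by rw [hSdef]; field_simp)
    hG1 hG2 hG3
    (by
      rw [hμ, ByzLearn.integral_iterateLaw_zero
        (f := fun x : ByzLearn.Family h d => P.avgLoss (ByzLearn.mean x))
        (hS.differentiable_avgLoss.continuous.measurable.comp
          ByzLearn.measurable_mean).stronglyMeasurable, ByzLearn.mean_const hh]
      exact hI.avgLoss hh)
    hcc₁ hcc₂ hT
  rw [hη] at hμ
  constructor
  · refine ByzLearn.lintegral_learn_le (by fun_prop) hT0
      (a := fun i => ∫ p, (ByzLearn.diameter p.1 : ℝ) ^ 2 ∂(μ i))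
      (fun i => integral_nonneg fun _ => by positivity) (fun i => ?_) hAsum
    rw [← hμ]
    exact ByzLearn.lintegral_diameter_sq_eq (hmem i).1
  · refine ByzLearn.lintegral_learn_le
      (((hS.continuous_gradient_avgLoss hL.le).measurable.comp
        ByzLearn.measurable_mean).enorm.pow_const 2) hT0
      (a := fun i => ∫ p, ‖∇ P.avgLoss (ByzLearn.mean p.1)‖ ^ 2 ∂(μ i))
      (fun i => integral_nonneg fun _ => by positivity) (fun i => ?_) hYsum
    rw [← hμ]
    exact ByzLearn.lintegral_enorm_sq_eq (hgradL i)
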